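/- Let $q$ be an odd prime power, $A=\mathbb{F}_q[t]$, $K=\mathbb{F}_q(t)$ and $K_\infty=\mathbb{F}_q((t^{-1}))$. Let $(V,Q)$ be a quadratic space over $K$ with $\dim_K V=3$ that is definite, i.e. $Q$ has no nontrivial zero on $V\otimes_K K_\infty$. Put $B(x,y)=\tfrac12\bigl(Q(x+y)-Q(x)-Q(y)\bigr)$. An integral lattice in $V$ is a finitely generated $A$-submodule $L\subset V$ that spans $V$ over $K$ and satisfies $B(L,L)\subset A$; it is called maximal if it is not properly contained in another integral lattice. Its determinant is $\det\bigl(B(e_i,e_j)\bigr)$, where $(e_1,e_2,e_3)$ is an $A$-basis of $L$; it is well defined up to squares of elements of $\mathbb{F}_q^\times$. For an integral lattice $L$, let $C(L)$ be the $A$-subalgebra of the Clifford algebra $C(V,Q)$ generated by $L$, and let $C_0(L)=C(L)\cap C_0(V,Q)$ be its even part, which is an $A$-order in the even Clifford algebra $C_0(V,Q)$. Let $D\in A$ be a square-free polynomial and assume that $V$ contains an integral lattice of determinant $D$. Suppose further that $Q$ is anisotropic over the completion $K_\mathfrak{p}$ for every prime $\mathfrak{p}$ of $A$ dividing $D$.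 Then an integral lattice $L\subset V$ is maximal if and only if $C_0(L)$ is a maximal $A$-order of $C_0(V,Q)$, i.e. an $A$-order that is not properly contained in another $A$-order of $C_0(V,Q)$. -/

import Mathlib

open Polynomial

namespace TernaryLattice

/-- Over a field `F` with `2 ≠ 0` (for a finite field: of odd order), `2` is invertible in `F(t)`. -/
noncomputable instance invertibleTwoRatFunc (F : Type*) [Field F] [NeZero (2 : F)] :
    Invertible (2 : RatFunc F) :=
  invertibleOfNonzero (by
    have h : algebraMap F (RatFunc F) 2 ≠ 0 :=
      (map_ne_zero (algebraMap F (RatFunc F))).2 (NeZero.ne 2)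
    rwa [map_ofNat] at h)

section Field

variable {K V : Type*} [Field K] [AddCommGroup V] [Module K V]

/-- The bilinear form `B(x, y) = (Q(x + y) - Q(x) - Q(y)) / 2`. -/
noncomputable def bil (Q : QuadraticForm K V) (x y : V) : K :=
  (Q (x + y) - Q x - Q y) / 2

/-- `Q` has no nontrivial zero on `E ⊗ V`, for a field extension `E` of `K`. -/
def AnisotropicOver [Invertible (2 : K)] (Q : QuadraticForm K V)
    (E : Type*) [Field E] [Algebra K E] : Prop :=
  (Q.baseChange E).Anisotropic

end Field

section Lattice

variable {A K V : Type*} [CommRing A] [Field K] [Algebra A K]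
  [AddCommGroup V] [Module K V] [Module A V] [IsScalarTower A K V]

/-- An integral `A`-lattice `L` in `V`: a finitely generated `A`-submodule spanning `V` over `K`,
with `B(L, L) ⊆ A`. -/
structure IsIntegralLattice (Q : QuadraticForm K V) (L : Submodule A V) : Prop where
  isLattice : Submodule.IsLattice K L
  integral : ∀ x ∈ L, ∀ y ∈ L, bil Q x y ∈ (algebraMap A K).range

/-- A maximal lattice: maximal for inclusion among the `A`-lattices with `B(L, L) ⊆ A`. -/
def IsMaximalLattice (Q : QuadraticForm K V) (L : Submodule A V) : Prop :=
  Maximal (IsIntegralLattice Q) L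

/-- The Clifford algebra `C(L)`, as the `A`-subalgebra of `C(V, Q)` generated by `L`. -/
def cliffordOrder (Q : QuadraticForm K V) (L : Submodule A V) :
    Subalgebra A (CliffordAlgebra Q) :=
  Algebra.adjoin A (CliffordAlgebra.ι Q '' (L : Set V))

/-- The even Clifford algebra `C₀(L) = C(L) ∩ C₀(V, Q)`, as an `A`-subalgebra of `C₀(V, Q)`. -/
def evenCliffordOrder (Q : QuadraticForm K V) (L : Submodule A V) :
    Subalgebra A (CliffordAlgebra.even Q) :=
  (cliffordOrder Q L).comap ((CliffordAlgebra.even Q).val.restrictScalars A)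

/-- An `A`-order in a `K`-algebra `C`: a subring containing `A` that is also an `A`-lattice. -/
def IsOrder {C : Type*} [Ring C] [Algebra K C] [Algebra A C] [IsScalarTower A K C]
    (Λ : Subalgebra A C) : Prop :=
  Submodule.IsLattice K (Subalgebra.toSubmodule Λ)

/-- A maximal order: maximal for inclusion among all `A`-orders of `C`. -/
def IsMaximalOrder {C : Type*} [Ring C] [Algebra K C] [Algebra A C] [IsScalarTower A K C]
    (Λ : Subalgebra A C) : Prop :=
  Maximal (IsOrder (K := K)) Λ

end Lattice

/-- `D` represents the determinant of the ternary `F[t]`-lattice `L`, that is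
`det (B(eᵢ, eⱼ)) = D` up to squares of nonzero constants, for a basis `e` of `L`. -/
def HasDeterminant {F V : Type*} [Field F] [AddCommGroup V] [Module (RatFunc F) V]
    [Module F[X] V] (Q : QuadraticForm (RatFunc F) V) (L : Submodule F[X] V) (D : F[X]) : Prop :=
  ∃ (e : Module.Basis (Fin 3) F[X] L) (u : Fˣ),
    (Matrix.of fun i j => bil Q (e i : V) (e j : V)).det =
      algebraMap F[X] (RatFunc F) (C (u : F) ^ 2 * D)

end TernaryLattice

/-! Both maximality properties are local, because an element lies in an `A`-module as soon as, for
each prime `p`, some multiple of it by an element outside `p` does. As 2 is a unit, `L` has at each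
`p` an orthogonal basis after localization (`exists_isAdaptedBasis`). In such a basis `a, b, c` are
the values of `Q`, and the localization of `C₀(L)` is free on `1, e₀e₁, e₀e₂, e₁e₂`: this is
`localOrder`, inside a quaternion algebra.

Order maximal implies lattice maximal: if `L ⊆ L'` then `C₀(L) = C₀(L')`, and the coordinates of `x
∈ L'` can be read off from `e₀x` and `e₁x`, which now lie in `C₀(L)`. This direction uses only that
`Q` is nondegenerate.

Lattice maximal implies order maximal: a maximal `L` has every `Q (eᵢ)` a unit or a uniformizer at
`p`, and the parity of the number of uniformizers is that of the valuation of `D`. If `p ∤ D`, the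
patterns left are three units, or one unit and two uniformizers. The second cannot occur in a space
containing a lattice unimodular at `p` (`not_unit_uniformizer_uniformizer`). When all three are
units, the trace form on the local order is unimodular, so no larger order exists. If `p ∣ D`, three
uniformizers are impossible because a ternary form over a finite field is isotropic; hence two units
`a, b` and a uniformizer `c`. By Hensel, anisotropy of `Q` makes `ax² + by²` anisotropic modulo `p`.
The reduced norm is the sum of a part of even valuation and a part of odd valuation, which cannot
cancel, so integral norm forces integral coordinates. Thus the local order contains every order
(`mem_localOrder_of_isAnisotropicPair`). -/

namespace TernaryLattice
open IsDedekindDomain WithZero Module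

/-! ### Bilinearity of `bil`. -/

section Bilinear

variable {K V : Type*} [Field K] [AddCommGroup V] [Module K V] (Q : QuadraticForm K V)

/-- The bilinear form `bil Q` as a bilinear map. -/
noncomputable def bilLin : V →ₗ[K] V →ₗ[K] K := (2 : K)⁻¹ • QuadraticMap.polarBilin Q

theorem bilLin_apply (x y : V) : bilLin Q x y = bil Q x y := by
  simp [bilLin, bil, QuadraticMap.polar, div_eq_inv_mul]

theorem bil_comm (x y : V) : bil Q x y = bil Q y x := by
  simp only [bil, add_comm x y]; ring

theorem bil_add_left (x y z : V) : bil Q (x + y) z = bil Q x z + bil Q y z := by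
  simp [← bilLin_apply]

theorem bil_add_right (x y z : V) : bil Q x (y + z) = bil Q x y + bil Q x z := by
  simp [← bilLin_apply]

theorem bil_smul_left (c : K) (x y : V) : bil Q (c • x) y = c * bil Q x y := by
  simp [← bilLin_apply]

theorem bil_smul_right (c : K) (x y : V) : bil Q x (c • y) = c * bil Q x y := by
  simp [← bilLin_apply]

theorem bil_zero_left (x : V) : bil Q 0 x = 0 := by
  simp [← bilLin_apply]

theorem bil_sum_left {ι : Type*} (s : Finset ι) (f : ι → V) (y : V) :
    bil Q (∑ i ∈ s, f i) y = ∑ i ∈ s, bil Q (f i) y := by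
  simp [← bilLin_apply]

theorem bil_sum_right {ι : Type*} (s : Finset ι) (x : V) (f : ι → V) :
    bil Q x (∑ i ∈ s, f i) = ∑ i ∈ s, bil Q x (f i) := by
  simp [← bilLin_apply]

variable (h2 : (2 : K) ≠ 0)
include h2

theorem bil_self (x : V) : bil Q x x = Q x := by
  have : Q (x + x) = 4 * Q x := by
    rw [← two_smul K x, QuadraticMap.map_smul]; norm_num
  rw [bil, this]; field_simp; ring

end Bilinear

/-! ### Coordinates in an orthogonal basis. -/

section OrthogonalBasis

variable {K V ι : Type*} [Field K] [AddCommGroup V] [Module K V] {Q : QuadraticForm K V}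
  [Fintype ι] {e : Basis ι K V}

theorem bil_basis_right (h2 : (2 : K) ≠ 0) (he : ∀ i j, i ≠ j → bil Q (e i) (e j) = 0)
    (x : V) (j : ι) :
    bil Q x (e j) = e.repr x j * Q (e j) := by
  classical
  conv_lhs => rw [← e.sum_repr x]
  rw [bil_sum_left, Finset.sum_eq_single j]
  · rw [bil_smul_left, bil_self Q h2]
  · intro i _ hij
    rw [bil_smul_left, he i j hij, mul_zero]
  · simp

theorem bil_eq_sum (h2 : (2 : K) ≠ 0) (he : ∀ i j, i ≠ j → bil Q (e i) (e j) = 0) (x y : V) :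
    bil Q x y = ∑ i, Q (e i) * (e.repr x i * e.repr y i) := by
  conv_lhs => rw [← e.sum_repr y]
  rw [bil_sum_right]
  refine Finset.sum_congr rfl fun i _ => ?_
  rw [bil_smul_right, bil_basis_right h2 he]; ring

theorem map_eq_sum (h2 : (2 : K) ≠ 0) (he : ∀ i j, i ≠ j → bil Q (e i) (e j) = 0) (x : V) :
    Q x = ∑ i, Q (e i) * e.repr x i ^ 2 := by
  rw [← bil_self Q h2, bil_eq_sum h2 he]
  simp only [sq]

end OrthogonalBasis

/-! ### Valuations at a prime, and the local-global principle. -/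

section Valuation

variable {A K : Type*} [CommRing A] [IsDomain A] [IsPrincipalIdealRing A] [Field K] [Algebra A K]
  [IsFractionRing A K] (p : HeightOneSpectrum A)

theorem exists_valuation_eq_exp_neg {x : K} (h0 : x ≠ 0) (h1 : p.valuation K x ≤ 1) :
    ∃ k : ℕ, p.valuation K x = exp (-(k : ℤ)) := by
  have hx : p.valuation K x ≠ 0 := (Valuation.ne_zero_iff _).2 h0
  have h3 := exp_log hx
  have h4 : log (p.valuation K x) ≤ 0 := by
    rw [← exp_le_exp, h3]; simpa using h1
  exact ⟨(-log (p.valuation K x)).toNat, by rw [Int.toNat_of_nonneg (by omega), neg_neg, h3]⟩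

theorem exists_mul_eq_of_valuation_le_one {x : K} (h : p.valuation K x ≤ 1) :
    ∃ (a s : A), s ∉ p.asIdeal ∧ algebraMap A K s * x = algebraMap A K a := by
  obtain ⟨a, s, h⟩ := p.exists_primeCompl_mul_eq_of_integer x h
  exact ⟨a, s, s.2, by rw [mul_comm, h]⟩

theorem valuation_algebraMap_eq_one {s : A} (hs : s ∉ p.asIdeal) :
    p.valuation K (algebraMap A K s) = 1 := p.valuation_eq_one_iff_notMem.2 hs

theorem exists_generator : ∃ t : A, p.asIdeal = Ideal.span {t} ∧ t ≠ 0 ∧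
    p.valuation K (algebraMap A K t) = exp (-1) := by
  obtain ⟨t, ht⟩ := (IsPrincipalIdealRing.principal p.asIdeal).principal
  have ht : p.asIdeal = Ideal.span {t} := ht
  have h0 : t ≠ 0 := by
    rintro rfl
    exact p.ne_bot (by simpa using ht)
  refine ⟨t, ht, h0, ?_⟩
  rw [p.valuation_of_algebraMap, p.intValuation_singleton h0 ht]

theorem valuation_two (h2 : IsUnit (2 : A)) : p.valuation K 2 = 1 := by
  have := valuation_algebraMap_eq_one (K := K) p (s := 2)
    fun h => p.isPrime.ne_top (Ideal.eq_top_of_isUnit_mem _ h h2)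
  rwa [map_ofNat] at this

omit [IsDomain A] [IsPrincipalIdealRing A] [IsFractionRing A K] in
theorem two_ne_zero_of_isUnit (h2 : IsUnit (2 : A)) : (2 : K) ≠ 0 := by
  have := (h2.map (algebraMap A K)).ne_zero
  rwa [map_ofNat] at this

-- The ideal of all `a` with `a • x ∈ L` is contained in no maximal ideal. Since `A` is not a field,
-- every maximal ideal is a height one prime.
omit [IsPrincipalIdealRing A] in
theorem mem_of_forall_exists_smul_mem {V : Type*} [AddCommGroup V] [Module A V] (hA : ¬ IsField A)
    {L : Submodule A V} {x : V}
    (h : ∀ p : HeightOneSpectrum A, ∃ s ∉ p.asIdeal, s • x ∈ L) : x ∈ L := by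
  let I : Ideal A := L.comap (LinearMap.toSpanSingleton A V x)
  have hI : I = ⊤ := by
    by_contra hI
    obtain ⟨m, hm, hIm⟩ := Ideal.exists_le_maximal I hI
    obtain ⟨s, hs, hsx⟩ := h ⟨m, hm.isPrime, Ring.ne_bot_of_isMaximal_of_not_isField hm hA⟩
    exact hs (hIm hsx)
  have : (1 : A) ∈ I := hI ▸ Submodule.mem_top
  simpa [I] using this

end Valuation

/-! ### Local orthogonal bases of lattices. -/

section AdaptedBasis

variable {A K V : Type*} [CommRing A] [IsDomain A] [IsPrincipalIdealRing A] [Field K] [Algebra A K]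
  [IsFractionRing A K] [AddCommGroup V] [Module K V] [Module A V] [IsScalarTower A K V]
  (p : HeightOneSpectrum A) (Q : QuadraticForm K V)

/-- Gram–Schmidt at `p`: split off a vector `x` of `N` whose `Q x` has the largest valuation, so
that projecting onto `x` has coefficients integral at `p`, and induct on the dimension of the span.
-/
theorem exists_orthogonal_family [FiniteDimensional K V] (hA2 : IsUnit (2 : A)) (n : ℕ) :
    ∀ N : Submodule A V, finrank K (Submodule.span K (N : Set V)) = n →
    (∀ x ∈ N, ∀ y ∈ N, p.valuation K (bil Q x y) ≤ 1) →
    (∀ x ∈ N, (∀ y ∈ N, bil Q x y = 0) → x = 0) →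
    ∃ (k : ℕ) (e : Fin k → V), (∀ i, e i ∈ N) ∧ (∀ i, Q (e i) ≠ 0) ∧
      (∀ i j, i ≠ j → bil Q (e i) (e j) = 0) ∧
      ∀ x ∈ N, ∃ c : Fin k → K, (∀ i, p.valuation K (c i) ≤ 1) ∧ x = ∑ i, c i • e i := by
  have h2 : (2 : K) ≠ 0 := two_ne_zero_of_isUnit hA2
  induction n using Nat.strong_induction_on with
  | _ n ih =>
  intro N hn hint hnd
  by_cases hN : ∀ x ∈ N, Q x = 0
  · refine ⟨0, Fin.elim0, fun i => i.elim0, fun i => i.elim0, fun i => i.elim0, fun x hx => ?_⟩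
    refine ⟨Fin.elim0, fun i => i.elim0, ?_⟩
    rw [Finset.univ_eq_empty, Finset.sum_empty]
    refine hnd x hx fun y hy => ?_
    rw [bil, hN _ (N.add_mem hx hy), hN x hx, hN y hy]; simp
  · push Not at hN
    have hex : ∃ k : ℕ, ∃ x ∈ N, p.valuation K (Q x) = exp (-(k : ℤ)) := by
      obtain ⟨x, hx, hQx⟩ := hN
      obtain ⟨k, hk⟩ := exists_valuation_eq_exp_neg p hQx
        (by simpa [bil_self Q h2] using hint x hx x hx)
      exact ⟨k, x, hx, hk⟩
    classical
    obtain ⟨x, hx, hkx⟩ := Nat.find_spec hex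
    have hmax : ∀ y ∈ N, p.valuation K (Q y) ≤ p.valuation K (Q x) := by
      intro y hy
      by_cases h0 : Q y = 0
      · simp [h0]
      obtain ⟨k, hk⟩ := exists_valuation_eq_exp_neg p h0
        (by simpa [bil_self Q h2] using hint y hy y hy)
      have := Nat.find_min' hex ⟨y, hy, hk⟩
      rw [hk, hkx, exp_le_exp]
      omega
    have hQx : Q x ≠ 0 := by
      intro h
      rw [h] at hkx
      simp only [map_zero] at hkx
      exact exp_ne_zero hkx.symm
    have hdiv : ∀ y ∈ N, p.valuation K (bil Q x y / Q x) ≤ 1 := by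
      intro y hy
      rw [map_div₀]
      refine div_le_one_of_le₀ ?_ zero_le
      -- Polarization: since 2 is a unit at `p`, maximality of `Q x` on `N` also bounds `bil Q x y`.
      rw [bil, map_div₀, valuation_two p hA2, div_one]
      exact (p.valuation K).map_sub_le
        ((p.valuation K).map_sub_le (hmax _ (N.add_mem hx hy)) le_rfl) (hmax y hy)
    -- `N` is a module over `A` only, so the projection is multiplied by its denominator `s`, a unit
    -- at `p`.
    have hproj : ∀ y ∈ N, ∃ (a s : A), s ∉ p.asIdeal ∧ s • y - a • x ∈ N ∧
        bil Q x (s • y - a • x) = 0 := by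
      intro y hy
      obtain ⟨a, s, hs, has⟩ := exists_mul_eq_of_valuation_le_one p (hdiv y hy)
      refine ⟨a, s, hs, N.sub_mem (N.smul_mem _ hy) (N.smul_mem _ hx), ?_⟩
      rw [sub_eq_add_neg, ← neg_smul, ← algebraMap_smul K s y, ← algebraMap_smul K (-a) x,
        bil_add_right, bil_smul_right, bil_smul_right, bil_self Q h2, map_neg, ← has]
      field_simp
      ring
    have hs0 : ∀ s : A, s ∉ p.asIdeal → algebraMap A K s ≠ 0 := by
      intro s hs h
      have := valuation_algebraMap_eq_one (K := K) p hs
      simp [h] at this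
    let N' : Submodule A V := N ⊓ (LinearMap.ker (bilLin Q x)).restrictScalars A
    have hN' : ∀ y, y ∈ N' ↔ y ∈ N ∧ bil Q x y = 0 := fun y => by
      simp [N', bilLin_apply]
    have hlt : finrank K (Submodule.span K (N' : Set V)) < n := by
      rw [← hn]
      refine Submodule.finrank_lt_finrank_of_lt (lt_of_le_of_ne
        (Submodule.span_mono fun y hy => ((hN' y).1 hy).1) fun heq => hQx ?_)
      have hle : Submodule.span K (N' : Set V) ≤ LinearMap.ker (bilLin Q x) :=
        Submodule.span_le.2 fun y hy => by simpa [bilLin_apply] using ((hN' y).1 hy).2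
      have := hle (heq ▸ Submodule.subset_span hx)
      rwa [LinearMap.mem_ker, bilLin_apply, bil_self Q h2] at this
    obtain ⟨k, e, he, hQe, horth, hspan⟩ := ih _ hlt N' rfl
      (fun y hy z hz => hint y ((hN' y).1 hy).1 z ((hN' z).1 hz).1) (by
        intro y hy hyz
        refine hnd y ((hN' y).1 hy).1 fun z hz => ?_
        obtain ⟨a, s, hs, hmem, h0⟩ := hproj z hz
        have h := hyz _ ((hN' _).2 ⟨hmem, h0⟩)
        rw [sub_eq_add_neg, ← neg_smul, ← algebraMap_smul K s z, ← algebraMap_smul K (-a) x,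
          bil_add_right, bil_smul_right, bil_smul_right, bil_comm Q y x, ((hN' y).1 hy).2,
          mul_zero, add_zero] at h
        exact (mul_eq_zero.1 h).resolve_left (hs0 s hs))
    refine ⟨k + 1, Fin.cons x e, Fin.cases hx fun i => ((hN' _).1 (he i)).1,
      Fin.cases hQx hQe, ?_, ?_⟩
    · refine Fin.cases (Fin.cases (fun h => absurd rfl h) fun j _ => ((hN' _).1 (he j)).2) fun i =>
        Fin.cases (fun _ => ?_) fun j hij => ?_
      · rw [Fin.cons_zero, Fin.cons_succ, bil_comm]
        exact ((hN' _).1 (he i)).2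
      · exact horth i j fun h => hij (congrArg _ h)
    · intro y hy
      obtain ⟨a, s, hs, hmem, h0⟩ := hproj y hy
      obtain ⟨c, hc, hsum⟩ := hspan _ ((hN' _).2 ⟨hmem, h0⟩)
      have hvs := valuation_algebraMap_eq_one (K := K) p hs
      refine ⟨Fin.cons (algebraMap A K a / algebraMap A K s) fun i => c i / algebraMap A K s,
        ?_, ?_⟩
      · refine Fin.cases ?_ fun i => ?_
        · rw [Fin.cons_zero, map_div₀, hvs, div_one]
          exact p.valuation_le_one a
        · rw [Fin.cons_succ, map_div₀, hvs, div_one]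
          exact hc i
      · rw [Fin.sum_univ_succ]
        simp only [Fin.cons_zero, Fin.cons_succ, div_eq_inv_mul, mul_smul]
        rw [← Finset.smul_sum, ← hsum, ← smul_add, algebraMap_smul, add_sub_cancel,
          ← algebraMap_smul K s y, inv_smul_smul₀ (hs0 s hs)]

/-- An orthogonal basis of `V` contained in `L` which generates `L` over the localization of `A`
at `p`. -/
structure IsAdaptedBasis (L : Submodule A V) (e : Basis (Fin 3) K V) : Prop where
  ortho : ∀ i j, i ≠ j → bil Q (e i) (e j) = 0
  mem : ∀ i, e i ∈ L
  valuation_repr_le : ∀ x ∈ L, ∀ i, p.valuation K (e.repr x i) ≤ 1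

theorem valuation_bil_le_one {Q : QuadraticForm K V} {L : Submodule A V}
    (hL : IsIntegralLattice Q L) {x y : V} (hx : x ∈ L) (hy : y ∈ L) :
    p.valuation K (bil Q x y) ≤ 1 := by
  obtain ⟨a, ha⟩ := hL.integral x hx y hy
  rw [← ha]
  exact p.valuation_le_one a

theorem exists_isAdaptedBasis (hdim : finrank K V = 3) (hA2 : IsUnit (2 : A))
    (hQ : ∀ x, (∀ y, bil Q x y = 0) → x = 0) {L : Submodule A V} (hL : IsIntegralLattice Q L) :
    ∃ e : Basis (Fin 3) K V, IsAdaptedBasis p Q L e := by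
  have h2 : (2 : K) ≠ 0 := two_ne_zero_of_isUnit hA2
  have : FiniteDimensional K V := FiniteDimensional.of_finrank_pos (by omega)
  have hspanL := hL.isLattice.span_eq_top
  obtain ⟨k, e, he, hQe, horth, hspan⟩ := exists_orthogonal_family p Q hA2 _ L rfl
    (fun x hx y hy => valuation_bil_le_one p hL hx hy) (by
      intro x _ hxy
      refine hQ x fun y => ?_
      have hle : Submodule.span K (L : Set V) ≤ LinearMap.ker (bilLin Q x) :=
        Submodule.span_le.2 fun y hy => by simpa [bilLin_apply] using hxy y hy
      have := hle (hspanL ▸ Submodule.mem_top : y ∈ _)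
      rwa [LinearMap.mem_ker, bilLin_apply] at this)
  have hli : LinearIndependent K e := by
    rw [Fintype.linearIndependent_iff]
    intro c hc i
    have := congrArg (fun z => bil Q z (e i)) hc
    simp only [bil_zero_left, bil_sum_left, bil_smul_left] at this
    rw [Finset.sum_eq_single i (fun j _ hj => by rw [horth j i hj, mul_zero]) (by simp),
      bil_self Q h2] at this
    exact (mul_eq_zero.1 this).resolve_right (hQe i)
  have htop : ⊤ ≤ Submodule.span K (Set.range e) := by
    rw [← hspanL, Submodule.span_le]
    intro x hx
    obtain ⟨c, -, rfl⟩ := hspan x hx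
    exact Submodule.sum_mem _ fun i _ => Submodule.smul_mem _ _ (Submodule.subset_span ⟨i, rfl⟩)
  have hk : k = 3 := by
    rw [← hdim, finrank_eq_card_basis (Basis.mk hli htop), Fintype.card_fin]
  subst hk
  refine ⟨Basis.mk hli htop, fun i j hij => ?_, fun i => ?_, fun x hx i => ?_⟩
  · simpa using horth i j hij
  · simpa using he i
  · obtain ⟨c, hc, rfl⟩ := hspan x hx
    have : (∑ i, c i • e i) = ∑ i, c i • Basis.mk hli htop i := by simp
    rw [this, Basis.repr_sum_self]
    exact hc i

end AdaptedBasis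
theorem le_exp_sub_one_of_lt_exp {x : ℤᵐ⁰} {n : ℤ} (h : x < exp n) : x ≤ exp (n - 1) := by
  rcases eq_or_ne x 0 with rfl | hx
  · exact zero_le
  · rw [← exp_log hx, exp_lt_exp] at h
    rw [← exp_log hx, exp_le_exp]
    omega

/-! ### Binary and ternary diagonal forms modulo a prime. -/

section Pair

variable {A K : Type*} [CommRing A] [IsDomain A] [IsPrincipalIdealRing A] [Field K] [Algebra A K]
  [IsFractionRing A K] (p : HeightOneSpectrum A)

/-- The binary form `a x² + b y²` is anisotropic at `p` in the strong sense that the valuation of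
each of its values is the larger of the valuations of the two terms. -/
def IsAnisotropicPair (a b : K) : Prop :=
  ∀ x y : K, p.valuation K (a * x ^ 2 + b * y ^ 2) =
    max (p.valuation K a * p.valuation K x ^ 2) (p.valuation K b * p.valuation K y ^ 2)

/-- If `x` and `y` have different valuations, so have the two terms. Otherwise divide by `y` and
approximate the unit `x / y` by an element `c` of `A`: a drop in valuation would persist for `c`. -/
theorem isAnisotropicPair_of_forall_not_lt {a b : K} (h0 : a ≠ 0)
    (hab : p.valuation K a = p.valuation K b)
    (h : ∀ c : A, ¬ p.valuation K (a * algebraMap A K c ^ 2 + b) < p.valuation K a) :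
    IsAnisotropicPair p a b := by
  intro x y
  have hva : p.valuation K a ≠ 0 := (Valuation.ne_zero_iff _).2 h0
  by_cases hxy : p.valuation K x = p.valuation K y
  swap
  · rw [Valuation.map_add_of_distinct_val, map_mul, map_mul, map_pow, map_pow]
    rw [map_mul, map_mul, map_pow, map_pow, ← hab]
    intro heq
    exact hxy ((pow_left_inj₀ zero_le zero_le two_ne_zero).1 (mul_left_cancel₀ hva heq))
  rw [hxy, hab, max_self]
  rcases eq_or_ne y 0 with rfl | hy
  · rw [map_zero, Valuation.zero_iff] at hxy
    simp [hxy]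
  have hvy : p.valuation K y ≠ 0 := (Valuation.ne_zero_iff _).2 hy
  have hz : p.valuation K (x / y) = 1 := by rw [map_div₀, hxy, div_self hvy]
  obtain ⟨c, hc⟩ := p.exists_valuation_sub_lt_of_integer hz.le 1
  rw [Units.val_one] at hc
  have hd : p.valuation K (a * algebraMap A K c ^ 2 - a * (x / y) ^ 2) < p.valuation K a := by
    have : a * algebraMap A K c ^ 2 - a * (x / y) ^ 2 =
        a * ((algebraMap A K c - x / y) * (algebraMap A K c + x / y)) := by ring
    rw [this, map_mul, map_mul]
    refine mul_lt_of_lt_one_right (zero_lt_iff.2 hva) ?_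
    refine (mul_le_of_le_one_right zero_le ?_).trans_lt hc
    exact Valuation.map_add_le _ (p.valuation_le_one c) hz.le
  have hge : p.valuation K a ≤ p.valuation K (a * algebraMap A K c ^ 2 + b) := not_lt.1 (h c)
  have hle : p.valuation K (a * algebraMap A K c ^ 2 + b) ≤ p.valuation K a := by
    refine Valuation.map_add_le _ ?_ hab.ge
    rw [map_mul, map_pow]
    exact mul_le_of_le_one_right zero_le (pow_le_one₀ zero_le (p.valuation_le_one c))
  have heq : p.valuation K (a * (x / y) ^ 2 + b) = p.valuation K a := by
    rw [← le_antisymm hle hge]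
    apply Valuation.map_eq_of_sub_lt
    rw [← Valuation.map_neg, le_antisymm hle hge]
    convert hd using 2
    ring
  have : a * x ^ 2 + b * y ^ 2 = (a * (x / y) ^ 2 + b) * y ^ 2 := by
    field_simp
  rw [this, map_mul, heq, map_pow, hab]

/-- After division by `c`, this is the solvability of `r x² + s y² + 1 = 0` over a finite field of
odd order. -/
theorem exists_valuation_ternary_lt [Finite (A ⧸ p.asIdeal)] (hA2 : IsUnit (2 : A)) {a b c : K}
    (hc : c ≠ 0) (hac : p.valuation K a = p.valuation K c)
    (hbc : p.valuation K b = p.valuation K c) :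
    ∃ x y : A, p.valuation K (a * algebraMap A K x ^ 2 + b * algebraMap A K y ^ 2 + c) <
      p.valuation K c := by
  have hvc : p.valuation K c ≠ 0 := (Valuation.ne_zero_iff _).2 hc
  have hlift : ∀ d : K, p.valuation K d = p.valuation K c →
      ∃ r : A, r ∉ p.asIdeal ∧ p.valuation K (algebraMap A K r - d / c) < 1 := by
    intro d hd
    have h1 : p.valuation K (d / c) = 1 := by rw [map_div₀, hd, div_self hvc]
    obtain ⟨r, hr⟩ := p.exists_valuation_sub_lt_of_integer h1.le 1
    rw [Units.val_one] at hr
    refine ⟨r, ?_, hr⟩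
    rw [← p.valuation_eq_one_iff_notMem (K := K), ← h1]
    apply Valuation.map_eq_of_sub_lt
    rwa [h1]
  obtain ⟨r, hr, hra⟩ := hlift a hac
  obtain ⟨s, hs, hsb⟩ := hlift b hbc
  have : p.asIdeal.IsMaximal := p.isMaximal
  let _ : Field (A ⧸ p.asIdeal) := Ideal.Quotient.field p.asIdeal
  let _ : Fintype (A ⧸ p.asIdeal) := Fintype.ofFinite _
  have h2 : (2 : A ⧸ p.asIdeal) ≠ 0 := by
    have := (hA2.map (Ideal.Quotient.mk p.asIdeal)).ne_zero
    rwa [map_ofNat] at this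
  have hr0 : Ideal.Quotient.mk p.asIdeal r ≠ 0 := by rwa [Ne, Ideal.Quotient.eq_zero_iff_mem]
  have hs0 : Ideal.Quotient.mk p.asIdeal s ≠ 0 := by rwa [Ne, Ideal.Quotient.eq_zero_iff_mem]
  obtain ⟨x, y, hxy⟩ := FiniteField.exists_root_sum_quadratic
    (f := C (Ideal.Quotient.mk p.asIdeal r) * X ^ 2)
    (g := C (Ideal.Quotient.mk p.asIdeal s) * X ^ 2 + C 1)
    (degree_C_mul_X_pow 2 hr0)
    (by rw [degree_add_C (by rw [degree_C_mul_X_pow 2 hs0]; norm_num), degree_C_mul_X_pow 2 hs0]; rfl)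
    (FiniteField.odd_card_of_char_ne_two (fun h => h2 (by
      have := ringChar.Nat.cast_ringChar (R := A ⧸ p.asIdeal)
      rwa [h] at this)))
  obtain ⟨x, rfl⟩ := Ideal.Quotient.mk_surjective x
  obtain ⟨y, rfl⟩ := Ideal.Quotient.mk_surjective y
  refine ⟨x, y, ?_⟩
  have hmem : p.valuation K (algebraMap A K (r * x ^ 2 + (s * y ^ 2 + 1))) < 1 := by
    rw [p.valuation_lt_one_iff_mem, ← Ideal.Quotient.eq_zero_iff_mem, ← hxy]
    simp
  have key : a * algebraMap A K x ^ 2 + b * algebraMap A K y ^ 2 + c =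
      c * (algebraMap A K (r * x ^ 2 + (s * y ^ 2 + 1)) -
        (algebraMap A K r - a / c) * algebraMap A K x ^ 2 -
        (algebraMap A K s - b / c) * algebraMap A K y ^ 2) := by
    simp only [map_add, map_mul, map_pow, map_one]
    field_simp
    ring
  have hsmall : ∀ (d : K) (x : A), p.valuation K d < 1 →
      p.valuation K (d * algebraMap A K x ^ 2) < 1 := by
    intro d x hd
    rw [map_mul, map_pow]
    exact (mul_le_of_le_one_right zero_le
      (pow_le_one₀ zero_le (p.valuation_le_one x))).trans_lt hd
  rw [key, map_mul]
  refine mul_lt_of_lt_one_right (zero_lt_iff.2 hvc) ?_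
  exact (p.valuation K).map_sub_lt ((p.valuation K).map_sub_lt hmem (hsmall _ _ hra))
    (hsmall _ _ hsb)

theorem pow_dvd_of_valuation_le {t : A} (ht : p.asIdeal = Ideal.span {t}) {a : A} {n : ℕ}
    (h : p.valuation K (algebraMap A K a) ≤ exp (-(n : ℤ))) : t ^ n ∣ a := by
  rw [p.valuation_of_algebraMap, p.intValuation_le_pow_iff_mem, ht, Ideal.span_singleton_pow,
    Ideal.mem_span_singleton] at h
  exact h

end Pair

/-! ### Local shape of a maximal lattice. -/

section Maximal

variable {A K V : Type*} [CommRing A] [IsDomain A] [IsPrincipalIdealRing A] [Field K] [Algebra A K]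
  [IsFractionRing A K] [AddCommGroup V] [Module K V] [Module A V] [IsScalarTower A K V]
  {p : HeightOneSpectrum A} {Q : QuadraticForm K V} {L : Submodule A V}

/-- The hypotheses say exactly that adjoining `t⁻¹ x` to `L` keeps it integral. -/
theorem inv_smul_mem_of_isMaximalLattice (h2 : (2 : K) ≠ 0) (hL : IsMaximalLattice Q L) {t : A}
    (ht : p.asIdeal = Ideal.span {t}) (ht0 : t ≠ 0) {x : V} (hx : x ∈ L)
    (hQ : p.valuation K (Q x) ≤ exp (-2))
    (hB : ∀ y ∈ L, p.valuation K (bil Q x y) ≤ exp (-1)) :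
    (algebraMap A K t)⁻¹ • x ∈ L := by
  have ht' : algebraMap A K t ≠ 0 := by simpa using ht0
  have hint := hL.prop.integral
  set z := (algebraMap A K t)⁻¹ • x with hz
  have hzz : bil Q z z ∈ (algebraMap A K).range := by
    obtain ⟨a, ha⟩ := hint x hx x hx
    rw [bil_self Q h2] at ha
    rw [← ha] at hQ
    obtain ⟨b, rfl⟩ := pow_dvd_of_valuation_le p ht (n := 2) hQ
    refine ⟨b, ?_⟩
    rw [hz, bil_smul_left, bil_smul_right, bil_self Q h2, ← ha, map_mul, map_pow]
    field_simp
  have hzy : ∀ y ∈ L, bil Q z y ∈ (algebraMap A K).range := by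
    intro y hy
    obtain ⟨a, ha⟩ := hint x hx y hy
    have h := hB y hy
    rw [← ha] at h
    obtain ⟨b, rfl⟩ := pow_dvd_of_valuation_le p ht (n := 1) h
    refine ⟨b, ?_⟩
    rw [hz, bil_smul_left, ← ha, map_mul, pow_one]
    field_simp
  clear_value z
  have hsup : IsIntegralLattice Q (L ⊔ Submodule.span A {z}) := by
    have := hL.prop.isLattice
    refine ⟨Submodule.IsLattice.of_le_of_isLattice_of_fg K le_sup_left
      (this.fg.sup (Submodule.fg_span_singleton z)), ?_⟩
    intro u hu w hw
    obtain ⟨u₁, hu₁, u₂, hu₂, rfl⟩ := Submodule.mem_sup.1 hu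
    obtain ⟨w₁, hw₁, w₂, hw₂, rfl⟩ := Submodule.mem_sup.1 hw
    obtain ⟨c, rfl⟩ := Submodule.mem_span_singleton.1 hu₂
    obtain ⟨d, rfl⟩ := Submodule.mem_span_singleton.1 hw₂
    rw [← algebraMap_smul K c z, ← algebraMap_smul K d z, bil_add_left, bil_add_right,
      bil_add_right, bil_smul_left, bil_smul_left, bil_smul_right, bil_smul_right,
      bil_comm Q u₁ z]
    exact add_mem (add_mem (hint _ hu₁ _ hw₁) (mul_mem ⟨d, rfl⟩ (hzy _ hu₁)))
      (add_mem (mul_mem ⟨c, rfl⟩ (hzy _ hw₁)) (mul_mem ⟨c, rfl⟩ (mul_mem ⟨d, rfl⟩ hzz)))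
  exact hL.le_of_ge hsup le_sup_left (Submodule.mem_sup_right (Submodule.mem_span_singleton_self z))

variable {e : Basis (Fin 3) K V}

/-- The vector `∑ cᵢ eᵢ` is divisible by the generator of `p` in `L`. In the next three lemmas some
`cᵢ` is 1, so this yields a contradiction: a nearly isotropic primitive vector cannot exist in a
maximal lattice. -/
theorem valuation_coeff_le_of_isMaximalLattice (hA2 : IsUnit (2 : A)) (hL : IsMaximalLattice Q L)
    (he : IsAdaptedBasis p Q L e) (c : Fin 3 → A)
    (hc : ∀ i, p.valuation K (Q (e i) * algebraMap A K (c i)) ≤ exp (-1))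
    (hQ : p.valuation K (∑ i, Q (e i) * algebraMap A K (c i) ^ 2) ≤ exp (-2)) (i : Fin 3) :
    p.valuation K (algebraMap A K (c i)) ≤ exp (-1) := by
  have h2 : (2 : K) ≠ 0 := two_ne_zero_of_isUnit hA2
  obtain ⟨t, ht, ht0, hvt⟩ := exists_generator (K := K) p
  have hrepr : ∀ i, e.repr (∑ i, algebraMap A K (c i) • e i) i = algebraMap A K (c i) := fun i => by
    rw [e.repr_sum_self]
  have hmem := inv_smul_mem_of_isMaximalLattice h2 hL ht ht0
    (x := ∑ i, algebraMap A K (c i) • e i)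
    (Submodule.sum_mem _ fun i _ => by
      rw [algebraMap_smul]; exact L.smul_mem _ (he.mem i))
    (by rw [map_eq_sum h2 he.ortho]; simpa only [hrepr] using hQ)
    (fun y hy => by
      rw [bil_eq_sum h2 he.ortho]
      refine Valuation.map_sum_le _ fun i _ => ?_
      rw [hrepr, ← mul_assoc, map_mul]
      exact (mul_le_of_le_one_right zero_le (he.valuation_repr_le y hy i)).trans (hc i))
  have := he.valuation_repr_le _ hmem i
  rw [map_smul, Finsupp.smul_apply, hrepr, smul_eq_mul, map_mul, map_inv₀, hvt, ← div_eq_inv_mul,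
    div_le_one₀ exp_pos] at this
  exact this

theorem valuation_map_basis_eq_of_isMaximalLattice (hA2 : IsUnit (2 : A))
    (hL : IsMaximalLattice Q L) (he : IsAdaptedBasis p Q L e) (i : Fin 3) :
    p.valuation K (Q (e i)) = 1 ∨ p.valuation K (Q (e i)) = exp (-1) := by
  have h2 : (2 : K) ≠ 0 := two_ne_zero_of_isUnit hA2
  have hle : p.valuation K (Q (e i)) ≤ 1 := by
    rw [← bil_self Q h2]
    exact valuation_bil_le_one p hL.prop (he.mem i) (he.mem i)
  rcases hle.eq_or_lt with h | h
  · exact Or.inl h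
  refine Or.inr ((le_exp_sub_one_of_lt_exp (n := 0) h).eq_or_lt.resolve_right fun h' => ?_)
  have h'' := le_exp_sub_one_of_lt_exp h'
  have key := valuation_coeff_le_of_isMaximalLattice hA2 hL he (Pi.single i 1) (fun j => by
      rcases eq_or_ne j i with rfl | hj
      · simpa using h'.le
      · simp [hj]) (by
      rw [Finset.sum_eq_single i (fun j _ hj => by simp [hj]) (by simp)]
      simpa using h'') i
  rw [Pi.single_eq_same, map_one, map_one, ← exp_zero, exp_le_exp] at key
  omega

theorem isAnisotropicPair_of_isMaximalLattice (hA2 : IsUnit (2 : A))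
    (hL : IsMaximalLattice Q L) (he : IsAdaptedBasis p Q L e) {i j : Fin 3} (hij : i ≠ j)
    (hi : p.valuation K (Q (e i)) = exp (-1)) (hj : p.valuation K (Q (e j)) = exp (-1)) :
    IsAnisotropicPair p (Q (e i)) (Q (e j)) := by
  refine isAnisotropicPair_of_forall_not_lt p ?_ (hi.trans hj.symm) fun c hc => ?_
  · rw [← Valuation.ne_zero_iff (p.valuation K), hi]; exact exp_ne_zero
  rw [hi] at hc
  have hv : ∀ a : A, p.valuation K (algebraMap A K a) ≤ 1 := p.valuation_le_one
  have key := valuation_coeff_le_of_isMaximalLattice hA2 hL he (Pi.single i c + Pi.single j 1)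
    (fun k => by
      rw [map_mul]
      rcases eq_or_ne k i with rfl | hki
      · rw [hi]; exact mul_le_of_le_one_right zero_le (hv _)
      rcases eq_or_ne k j with rfl | hkj
      · rw [hj]; exact mul_le_of_le_one_right zero_le (hv _)
      · simp [hki, hkj]) (by
      rw [Finset.sum_eq_add i j hij (fun k _ hk => by simp [hk.1, hk.2]) (by simp) (by simp)]
      simpa [hij, hij.symm] using le_exp_sub_one_of_lt_exp hc) j
  simp only [Pi.add_apply, Pi.single_eq_same, Pi.single_eq_of_ne hij.symm, zero_add, map_one] at key
  rw [← exp_zero, exp_le_exp] at key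
  omega

theorem exists_valuation_ne_of_isMaximalLattice [Finite (A ⧸ p.asIdeal)] (hA2 : IsUnit (2 : A))
    (hL : IsMaximalLattice Q L) (he : IsAdaptedBasis p Q L e) :
    ∃ i, p.valuation K (Q (e i)) ≠ exp (-1) := by
  by_contra! h
  have hv : ∀ a : A, p.valuation K (algebraMap A K a) ≤ 1 := p.valuation_le_one
  obtain ⟨x, y, hxy⟩ := exists_valuation_ternary_lt p hA2 (a := Q (e 0)) (b := Q (e 1))
    (c := Q (e 2)) (by rw [← Valuation.ne_zero_iff (p.valuation K), h]; exact exp_ne_zero)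
    (by rw [h, h]) (by rw [h, h])
  rw [h] at hxy
  have key := valuation_coeff_le_of_isMaximalLattice hA2 hL he ![x, y, 1] (fun i => by
      rw [map_mul, h]
      exact mul_le_of_le_one_right zero_le (hv _)) (by
      rw [Fin.sum_univ_three]
      simpa using le_exp_sub_one_of_lt_exp hxy) 2
  simp only [Matrix.cons_val, map_one] at key
  rw [← exp_zero, exp_le_exp] at key
  omega

end Maximal
-- Gram determinants and nondegeneracy.
section Determinant

variable {K V : Type*} [Field K] [AddCommGroup V] [Module K V] {Q : QuadraticForm K V}

theorem det_bil_eq {e : Basis (Fin 3) K V} (h2 : (2 : K) ≠ 0)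
    (he : ∀ i j, i ≠ j → bil Q (e i) (e j) = 0) (m : Fin 3 → V) :
    (Matrix.of fun i j => bil Q (m i) (m j)).det =
      (e.toMatrix m).det ^ 2 * ∏ i, Q (e i) := by
  have : (Matrix.of fun i j => bil Q (m i) (m j)) =
      (e.toMatrix m).transpose * Matrix.diagonal (fun i => Q (e i)) * e.toMatrix m := by
    ext i j
    rw [Matrix.of_apply, bil_eq_sum h2 he, Matrix.mul_apply]
    refine Finset.sum_congr rfl fun k _ => ?_
    rw [Matrix.mul_diagonal, Matrix.transpose_apply, Basis.toMatrix_apply, Basis.toMatrix_apply]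
    ring
  rw [this, Matrix.det_mul, Matrix.det_mul, Matrix.det_transpose, Matrix.det_diagonal]
  ring

theorem eq_zero_of_forall_bil_eq_zero (m : Basis (Fin 3) K V)
    (hm : (Matrix.of fun i j => bil Q (m i) (m j)).det ≠ 0) {x : V} (hx : ∀ y, bil Q x y = 0) :
    x = 0 := by
  have h : Matrix.vecMul (m.repr x) (Matrix.of fun i j => bil Q (m i) (m j)) = 0 := by
    ext j
    rw [Pi.zero_apply, ← hx (m j)]
    conv_rhs => rw [← m.sum_repr x]
    rw [bil_sum_left]
    simp [Matrix.vecMul, dotProduct, bil_smul_left]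
  have h0 := Matrix.eq_zero_of_vecMul_eq_zero hm h
  rw [← m.sum_repr x]
  exact Finset.sum_eq_zero fun i _ => by rw [h0, Pi.zero_apply, zero_smul]

end Determinant

/-! ### Uniformizers in a maximal lattice: counting by the determinant. -/

section Local

variable {A K V : Type*} [CommRing A] [IsDomain A] [IsPrincipalIdealRing A] [Field K] [Algebra A K]
  [IsFractionRing A K] [AddCommGroup V] [Module K V] [Module A V] [IsScalarTower A K V]
  {p : HeightOneSpectrum A} {Q : QuadraticForm K V} {L M : Submodule A V}

omit [IsScalarTower A K V] in
theorem IsAdaptedBasis.reindex {e : Basis (Fin 3) K V} (he : IsAdaptedBasis p Q L e)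
    (σ : Equiv.Perm (Fin 3)) : IsAdaptedBasis p Q L (e.reindex σ) where
  ortho i j hij := by
    rw [Basis.reindex_apply, Basis.reindex_apply]
    exact he.ortho _ _ fun h => hij (σ.symm.injective h)
  mem i := by rw [Basis.reindex_apply]; exact he.mem _
  valuation_repr_le x hx i := by
    rw [Basis.repr_reindex_apply]; exact he.valuation_repr_le x hx _

theorem valuation_det_le_one {n : Type*} [Fintype n] [DecidableEq n] {P : Matrix n n K}
    (hP : ∀ i j, p.valuation K (P i j) ≤ 1) : p.valuation K P.det ≤ 1 := by
  rw [Matrix.det_apply]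
  refine Valuation.map_sum_le _ fun σ _ => ?_
  rw [Units.smul_def, zsmul_eq_mul, map_mul, map_prod]
  refine mul_le_one' ?_ (Finset.prod_le_one' fun i _ => hP _ _)
  rcases Int.units_eq_one_or (Equiv.Perm.sign σ) with h | h <;> simp [h, Valuation.map_neg]

omit [IsScalarTower A K V] in
-- Gram determinants of two bases differ by a square, so the parity of their valuation is an
-- invariant of the space; `m` need not lie in `L`.
theorem exists_valuation_det_eq {e : Basis (Fin 3) K V} (hA2 : IsUnit (2 : A))
    (he : IsAdaptedBasis p Q L e) (m : Fin 3 → V)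
    (hm : (Matrix.of fun i j => bil Q (m i) (m j)).det ≠ 0) :
    ∃ k : ℤ, p.valuation K (Matrix.of fun i j => bil Q (m i) (m j)).det =
      exp (2 * k) * ∏ i, p.valuation K (Q (e i)) := by
  rw [det_bil_eq (two_ne_zero_of_isUnit hA2) he.ortho] at hm ⊢
  have h0 : (e.toMatrix m).det ≠ 0 := fun h => hm (by rw [h]; ring)
  refine ⟨log (p.valuation K (e.toMatrix m).det), ?_⟩
  rw [map_mul, map_pow, map_prod, two_mul, exp_add, exp_log ((Valuation.ne_zero_iff _).2 h0), sq]

/-- The determinant is a product of factors integral at `p`; if it is a unit, each factor is. -/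
theorem valuation_map_basis_eq_one {e : Basis (Fin 3) K V} (hA2 : IsUnit (2 : A))
    (hL : IsIntegralLattice Q L) (he : IsAdaptedBasis p Q L e) {m : Fin 3 → V} (hmL : ∀ i, m i ∈ L)
    (hm : p.valuation K (Matrix.of fun i j => bil Q (m i) (m j)).det = 1) (i : Fin 3) :
    p.valuation K (Q (e i)) = 1 := by
  have h2 : (2 : K) ≠ 0 := two_ne_zero_of_isUnit hA2
  have hle : ∀ i, p.valuation K (Q (e i)) ≤ 1 := fun i => by
    rw [← bil_self Q h2]
    exact valuation_bil_le_one p hL (he.mem i) (he.mem i)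
  have hdet : p.valuation K (e.toMatrix m).det ≤ 1 := valuation_det_le_one fun i j => by
    rw [Basis.toMatrix_apply]
    exact he.valuation_repr_le _ (hmL j) i
  rw [det_bil_eq h2 he.ortho, map_mul, map_pow, map_prod,
    ← Finset.mul_prod_erase _ _ (Finset.mem_univ i)] at hm
  refine le_antisymm (hle i) (hm.ge.trans ?_)
  refine (mul_le_of_le_one_left zero_le (pow_le_one₀ zero_le hdet)).trans ?_
  exact mul_le_of_le_one_right zero_le (Finset.prod_le_one' fun j _ => hle j)

/-- Integrality of `Q` on `M` bounds the last `e`-coordinate of every vector of `M`. Then `t⁻¹ e₂`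
pairs integrally with `M`, so it lies in the unimodular lattice `M` locally, although its last
coordinate is `t⁻¹`. -/
theorem not_unit_uniformizer_uniformizer {e f : Basis (Fin 3) K V} (hA2 : IsUnit (2 : A))
    (hL : IsMaximalLattice Q L) (he : IsAdaptedBasis p Q L e)
    (hM : IsIntegralLattice Q M) (hf : IsAdaptedBasis p Q M f)
    (hQf : ∀ i, p.valuation K (Q (f i)) = 1) (h0 : p.valuation K (Q (e 0)) = 1)
    (h1 : p.valuation K (Q (e 1)) = exp (-1)) (h2 : p.valuation K (Q (e 2)) = exp (-1)) :
    False := by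
  have h2K : (2 : K) ≠ 0 := two_ne_zero_of_isUnit hA2
  have hpair := isAnisotropicPair_of_isMaximalLattice hA2 hL he (i := 1) (j := 2) (by decide) h1 h2
  have hML : ∀ x ∈ M, p.valuation K (e.repr x 2) ≤ 1 := by
    intro x hx
    have hQx : p.valuation K (Q x) ≤ 1 := by
      rw [← bil_self Q h2K]
      exact valuation_bil_le_one p hM hx hx
    rcases eq_or_ne (e.repr x 2) 0 with h | hx2
    · simp [h]
    rw [map_eq_sum h2K he.ortho, Fin.sum_univ_three, add_assoc] at hQx
    have hp := hpair (e.repr x 1) (e.repr x 2)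
    -- The left side has odd valuation because the pair is anisotropic, while the right side is zero
    -- or has even valuation.
    have hne : p.valuation K (Q (e 1) * e.repr x 1 ^ 2 + Q (e 2) * e.repr x 2 ^ 2) ≠
        p.valuation K (Q (e 0) * e.repr x 0 ^ 2) := by
      rw [hp, h1, h2, map_mul, h0, one_mul, map_pow, ← mul_max]
      have hsq : ∃ w : K, w ≠ 0 ∧
          max (p.valuation K (e.repr x 1) ^ 2) (p.valuation K (e.repr x 2) ^ 2) =
            p.valuation K w ^ 2 := by
        rcases le_total (p.valuation K (e.repr x 1)) (p.valuation K (e.repr x 2)) with h | h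
        · exact ⟨_, hx2, max_eq_right (pow_le_pow_left₀ zero_le h 2)⟩
        · refine ⟨e.repr x 1, ?_, max_eq_left (pow_le_pow_left₀ zero_le h 2)⟩
          rintro h1
          rw [h1, map_zero] at h
          exact hx2 ((Valuation.zero_iff _).1 (le_zero_iff.1 h))
      obtain ⟨w, hw, hmax⟩ := hsq
      rw [hmax]
      intro heq
      have hvw : p.valuation K w ≠ 0 := (Valuation.ne_zero_iff _).2 hw
      have hvx : p.valuation K (e.repr x 0) ≠ 0 := by
        intro h
        rw [h] at heq
        rw [zero_pow two_ne_zero] at heq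
        exact mul_ne_zero exp_ne_zero (pow_ne_zero 2 hvw) heq
      rw [← exp_log hvw, ← exp_log hvx, ← exp_nsmul, ← exp_nsmul, ← exp_add, exp_inj] at heq
      simp only [nsmul_eq_mul, Nat.cast_ofNat] at heq
      omega
    rw [add_comm, Valuation.map_add_of_distinct_val _ hne, hp] at hQx
    have hle := ((le_max_right _ _).trans (le_max_left _ _)).trans hQx
    rw [h2] at hle
    -- The bound is `2k - 1 ≤ 0` on the exponent `k` of the coordinate, and `k` is an integer, so `k
    -- ≤ 0`.
    by_contra! hlt
    have hvx : p.valuation K (e.repr x 2) ≠ 0 := (Valuation.ne_zero_iff _).2 hx2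
    rw [← exp_log hvx, ← exp_zero, exp_lt_exp] at hlt
    rw [← exp_log hvx, ← exp_nsmul, ← exp_add, ← exp_zero, exp_le_exp] at hle
    simp only [nsmul_eq_mul, Nat.cast_ofNat] at hle
    omega
  obtain ⟨t, ht, ht0, hvt⟩ := exists_generator (K := K) p
  set y := (algebraMap A K t)⁻¹ • e 2 with hy
  -- Self-duality of `M` at `p`: the `f`-coordinates of `y` are its products with the `fᵢ`, up to
  -- units.
  have hcoord : ∀ i, p.valuation K (f.repr y i) ≤ 1 := by
    intro i
    have hne : Q (f i) ≠ 0 := by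
      rw [← Valuation.ne_zero_iff (p.valuation K), hQf]; exact one_ne_zero
    have : f.repr y i = (algebraMap A K t)⁻¹ * (Q (e 2) * e.repr (f i) 2) / Q (f i) := by
      rw [eq_div_iff hne, ← bil_basis_right h2K hf.ortho, hy, bil_smul_left, bil_comm,
        bil_basis_right h2K he.ortho]
      ring
    rw [this, map_div₀, map_mul, map_mul, map_inv₀, hvt, h2, hQf, div_one, ← mul_assoc,
      inv_mul_cancel₀ exp_ne_zero, one_mul]
    exact hML _ (hf.mem i)
  have hy2 : p.valuation K (e.repr y 2) ≤ 1 := by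
    rw [← f.sum_repr y, map_sum, Finsupp.finsetSum_apply]
    refine Valuation.map_sum_le _ fun i _ => ?_
    rw [map_smul, Finsupp.smul_apply, smul_eq_mul, map_mul]
    exact mul_le_one' (hcoord i) (hML _ (hf.mem i))
  rw [hy, map_smul, Finsupp.smul_apply, e.repr_self, Finsupp.single_eq_same, smul_eq_mul, mul_one,
    map_inv₀, hvt, ← exp_neg, neg_neg, ← exp_zero, exp_le_exp] at hy2
  omega

/-- At a prime where the space contains a unimodular lattice, maximal lattices are unimodular. -/
theorem valuation_map_basis_eq_one_of_isMaximalLattice {e f : Basis (Fin 3) K V}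
    (hA2 : IsUnit (2 : A)) (hL : IsMaximalLattice Q L) (he : IsAdaptedBasis p Q L e)
    (hM : IsIntegralLattice Q M) (hf : IsAdaptedBasis p Q M f) {m : Fin 3 → V}
    (hmM : ∀ i, m i ∈ M)
    (hm : p.valuation K (Matrix.of fun i j => bil Q (m i) (m j)).det = 1) (i : Fin 3) :
    p.valuation K (Q (e i)) = 1 := by
  have hQf := valuation_map_basis_eq_one hA2 hM hf hmM hm
  have hval := valuation_map_basis_eq_of_isMaximalLattice hA2 hL he
  have hm0 : (Matrix.of fun i j => bil Q (m i) (m j)).det ≠ 0 := by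
    rw [← Valuation.ne_zero_iff (p.valuation K), hm]; exact one_ne_zero
  obtain ⟨k, hk⟩ := exists_valuation_det_eq hA2 he m hm0
  rw [hm, Fin.prod_univ_three] at hk
  have key : ∀ σ : Equiv.Perm (Fin 3), p.valuation K (Q (e (σ.symm 0))) = 1 →
      p.valuation K (Q (e (σ.symm 1))) = exp (-1) → p.valuation K (Q (e (σ.symm 2))) = exp (-1) →
      False := fun σ h0 h1 h2 =>
    not_unit_uniformizer_uniformizer hA2 hL (he.reindex σ) hM hf hQf (by simpa using h0)
      (by simpa using h1) (by simpa using h2)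
  have hall : ∀ i, p.valuation K (Q (e i)) = 1 := by
    -- The parity in `hk` rules out one or three uniformizers; the cases with two go to `key`.
    rcases hval 0 with h0 | h0 <;> rcases hval 1 with h1 | h1 <;> rcases hval 2 with h2 | h2
    case inl.inl.inl => intro i; fin_cases i <;> assumption
    case inl.inr.inr => exact (key 1 h0 h1 h2).elim
    case inr.inl.inr => exact (key (Equiv.swap 0 1) h1 h0 h2).elim
    case inr.inr.inl => exact (key (Equiv.swap 0 2) h2 h1 h0).elim
    all_goals
      rw [h0, h1, h2] at hk
      simp only [mul_one, one_mul, ← exp_add] at hk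
      rw [← exp_zero, exp_inj] at hk
      omega
  exact hall i

/-- The number of uniformizers is odd, and three are excluded by isotropy of ternary forms over the
residue field. It remains to move the single one to the last place. -/
theorem exists_isAdaptedBasis_of_odd [Finite (A ⧸ p.asIdeal)] {e : Basis (Fin 3) K V}
    (hA2 : IsUnit (2 : A)) (hL : IsMaximalLattice Q L) (he : IsAdaptedBasis p Q L e)
    {m : Fin 3 → V}
    (hm : p.valuation K (Matrix.of fun i j => bil Q (m i) (m j)).det = exp (-1)) :
    ∃ e' : Basis (Fin 3) K V, IsAdaptedBasis p Q L e' ∧ p.valuation K (Q (e' 0)) = 1 ∧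
      p.valuation K (Q (e' 1)) = 1 ∧ p.valuation K (Q (e' 2)) = exp (-1) := by
  have hval := valuation_map_basis_eq_of_isMaximalLattice hA2 hL he
  have hm0 : (Matrix.of fun i j => bil Q (m i) (m j)).det ≠ 0 := by
    rw [← Valuation.ne_zero_iff (p.valuation K), hm]; exact exp_ne_zero
  obtain ⟨k, hk⟩ := exists_valuation_det_eq hA2 he m hm0
  rw [hm, Fin.prod_univ_three] at hk
  have key : ∀ σ : Equiv.Perm (Fin 3), p.valuation K (Q (e (σ.symm 0))) = 1 →
      p.valuation K (Q (e (σ.symm 1))) = 1 → p.valuation K (Q (e (σ.symm 2))) = exp (-1) →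
      ∃ e' : Basis (Fin 3) K V, IsAdaptedBasis p Q L e' ∧ p.valuation K (Q (e' 0)) = 1 ∧
      p.valuation K (Q (e' 1)) = 1 ∧ p.valuation K (Q (e' 2)) = exp (-1) := fun σ h0 h1 h2 =>
    ⟨e.reindex σ, he.reindex σ, by simpa using h0, by simpa using h1, by simpa using h2⟩
  rcases hval 0 with h0 | h0 <;> rcases hval 1 with h1 | h1 <;> rcases hval 2 with h2 | h2
  case inl.inl.inr => exact key 1 h0 h1 h2
  case inl.inr.inl => exact key (Equiv.swap 1 2) h0 h2 h1
  case inr.inl.inl => exact key (Equiv.swap 0 2) h2 h1 h0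
  case inr.inr.inr =>
    obtain ⟨i, hi⟩ := exists_valuation_ne_of_isMaximalLattice hA2 hL he
    exact (hi (by fin_cases i <;> assumption)).elim
  all_goals
    rw [h0, h1, h2] at hk
    simp only [mul_one, one_mul, ← exp_add] at hk
    rw [exp_inj] at hk
    omega

end Local

end TernaryLattice

namespace TernaryLattice
open IsDedekindDomain WithZero Module
-- Square roots in complete discretely valued fields.
section Hensel

open Filter Topology

variable {E : Type*} [Field E] [hE : Valued E ℤᵐ⁰]

theorem tendsto_zero_of_valuation_le_exp {δ : ℕ → E}
    (h : ∀ n : ℕ, Valued.v (δ n) ≤ exp (-(n : ℤ))) : Tendsto δ atTop (𝓝 0) := by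
  rw [(Valued.hasBasis_nhds_zero E ℤᵐ⁰).tendsto_right_iff]
  intro γ _
  simp only [Set.mem_ofPred_eq, Valuation.restrict_lt_iff_lt_embedding]
  have hγ : MonoidWithZeroHom.ValueGroup₀.embedding γ.1 ≠ (0 : ℤᵐ⁰) := by simp
  filter_upwards [eventually_gt_atTop (-log (MonoidWithZeroHom.ValueGroup₀.embedding γ.1)).toNat]
    with n hn
  refine (h n).trans_lt ?_
  rw [← exp_log hγ, exp_lt_exp]
  omega

theorem cauchySeq_of_valuation_sub_le_exp {x : ℕ → E}
    (h : ∀ n : ℕ, Valued.v (x (n + 1) - x n) ≤ exp (-(n : ℤ))) : CauchySeq x := by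
  have hle : ∀ n k : ℕ, Valued.v (x (n + k) - x n) ≤ exp (-(n : ℤ)) := by
    intro n k
    induction k with
    | zero => simp
    | succ k ih =>
      rw [show x (n + (k + 1)) - x n = (x (n + k + 1) - x (n + k)) + (x (n + k) - x n) by
        rw [add_assoc]; ring]
      refine Valuation.map_add_le _ ((h _).trans ?_) ih
      rw [exp_le_exp]; omega
  rw [(Valued.hasBasis_uniformity E ℤᵐ⁰).cauchySeq_iff']
  intro γ _
  have hγ : MonoidWithZeroHom.ValueGroup₀.embedding γ.1 ≠ (0 : ℤᵐ⁰) := by simp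
  refine ⟨(-log (MonoidWithZeroHom.ValueGroup₀.embedding γ.1)).toNat + 1, fun n hn => ?_⟩
  obtain ⟨k, rfl⟩ := Nat.exists_eq_add_of_le hn
  simp only [Set.mem_ofPred_eq, Valuation.restrict_lt_iff_lt_embedding]
  rw [Valuation.map_sub_swap]
  refine (hle _ k).trans_lt ?_
  rw [← lt_log_iff_exp_lt hγ]
  push_cast
  omega

/-- Newton's iteration for the square root of `u`. -/
def newtonSqrt (u c : E) : ℕ → E
  | 0 => c
  | n + 1 => newtonSqrt u c n - (newtonSqrt u c n ^ 2 - u) / (2 * newtonSqrt u c n)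

/-- One Newton step replaces the error `x² - u` by the square of `(x² - u) / (2x)`, with `2x` a
unit. The linear bound carried through the induction is weaker than this but suffices for
convergence. -/
theorem exists_sq_eq_of_valuation_sub_lt [CompleteSpace E] [T2Space E]
    (h2 : Valued.v (2 : E) = 1) {u c : E} (hc : Valued.v c = 1)
    (h : Valued.v (c ^ 2 - u) < 1) : ∃ z : E, z ^ 2 = u := by
  have hx : ∀ n : ℕ, Valued.v (newtonSqrt u c n) = 1 ∧
      Valued.v (newtonSqrt u c n ^ 2 - u) ≤ exp (-(n : ℤ) - 1) := by
    intro n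
    induction n with
    | zero => exact ⟨hc, le_exp_sub_one_of_lt_exp (by simpa [newtonSqrt] using h)⟩
    | succ n ih =>
      obtain ⟨h1, hd⟩ := ih
      have hx0 : newtonSqrt u c n ≠ 0 := by
        rw [← Valuation.ne_zero_iff (Valued.v : Valuation E ℤᵐ⁰), h1]; exact one_ne_zero
      have h20 : (2 : E) ≠ 0 := by
        rw [← Valuation.ne_zero_iff (Valued.v : Valuation E ℤᵐ⁰), h2]; exact one_ne_zero
      have hq : Valued.v ((newtonSqrt u c n ^ 2 - u) / (2 * newtonSqrt u c n)) ≤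
          exp (-(n : ℤ) - 1) := by
        rwa [map_div₀, map_mul, h1, h2, mul_one, div_one]
      constructor
      · rw [newtonSqrt, Valuation.map_sub_eq_of_lt_left, h1]
        rw [h1, ← exp_zero]
        refine hq.trans_lt ?_
        rw [exp_lt_exp]; omega
      · have : newtonSqrt u c (n + 1) ^ 2 - u =
            ((newtonSqrt u c n ^ 2 - u) / (2 * newtonSqrt u c n)) ^ 2 := by
          rw [newtonSqrt]
          field_simp
          ring
        rw [this, map_pow, sq]
        refine (mul_le_mul' hq hq).trans ?_
        rw [← exp_add, exp_le_exp]
        push_cast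
        omega
  obtain ⟨z, hz⟩ := cauchySeq_tendsto_of_complete
    (cauchySeq_of_valuation_sub_le_exp (x := newtonSqrt u c) fun n => by
      rw [newtonSqrt, sub_sub_cancel_left, Valuation.map_neg, map_div₀, map_mul, (hx n).1, h2,
        mul_one, div_one]
      exact (hx n).2.trans (by rw [exp_le_exp]; omega))
  have h0 := tendsto_zero_of_valuation_le_exp fun n =>
    (hx n).2.trans (by rw [exp_le_exp]; omega : exp (-(n : ℤ) - 1) ≤ exp (-(n : ℤ)))
  exact ⟨z, sub_eq_zero.1 (tendsto_nhds_unique ((hz.pow 2).sub_const u) h0)⟩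

end Hensel

/-! ### From anisotropy over the completion to anisotropy modulo the prime. -/

section Anisotropic

open TensorProduct

variable {A K V : Type*} [CommRing A] [IsDomain A] [IsPrincipalIdealRing A] [Field K] [Algebra A K]
  [IsFractionRing A K] [AddCommGroup V] [Module K V] {p : HeightOneSpectrum A}
  {Q : QuadraticForm K V}

/-- The vector `z ⊗ eᵢ + 1 ⊗ eⱼ` is isotropic, and nonzero since its `j`-th coordinate is 1. -/
theorem not_anisotropicOver_of_sq_mul_eq [Invertible (2 : K)] {E : Type*} [Field E] [Algebra K E]
    {e : Basis (Fin 3) K V} (he : ∀ i j, i ≠ j → bil Q (e i) (e j) = 0) {i j : Fin 3} (hij : i ≠ j)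
    {z : E} (hz : algebraMap K E (Q (e i)) * z ^ 2 + algebraMap K E (Q (e j)) = 0) :
    ¬ AnisotropicOver Q E := by
  intro h
  let _ : Invertible (2 : E) :=
    (Invertible.map (algebraMap K E) 2).copy 2 (map_ofNat _ _).symm
  have hpolar : QuadraticMap.polar Q (e i) (e j) = 0 := by
    have := he i j hij
    rw [bil, div_eq_zero_iff] at this
    exact this.resolve_right (Invertible.ne_zero 2)
  have h0 : z ⊗ₜ[K] e i + (1 : E) ⊗ₜ[K] e j = 0 := by
    refine h _ ?_
    have hsum := QuadraticMap.map_add (Q.baseChange E) (z ⊗ₜ[K] e i) ((1 : E) ⊗ₜ[K] e j)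
    rw [hsum, QuadraticForm.baseChange_tmul, QuadraticForm.baseChange_tmul,
      ← QuadraticMap.polarBilin_apply_apply, QuadraticForm.polarBilin_baseChange]
    simp only [LinearMap.BilinForm.baseChange_tmul, QuadraticMap.polarBilin_apply_apply, hpolar]
    simpa [Algebra.smul_def, sq] using hz
  have := congrArg (fun w => (Algebra.TensorProduct.basis E e).repr w j) h0
  simp [hij] at this

/-- A zero modulo `p` of the binary form would lift, by Hensel, to a square root of `-Q (eⱼ) / Q
(eᵢ)` in the completion. -/
theorem isAnisotropicPair_of_anisotropicOver [Invertible (2 : K)] (hA2 : IsUnit (2 : A))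
    {e : Basis (Fin 3) K V} (he : ∀ i j, i ≠ j → bil Q (e i) (e j) = 0) {i j : Fin 3} (hij : i ≠ j)
    (hi : p.valuation K (Q (e i)) = 1) (hj : p.valuation K (Q (e j)) = 1)
    (h : AnisotropicOver Q (p.adicCompletion K)) :
    IsAnisotropicPair p (Q (e i)) (Q (e j)) := by
  have hi0 : Q (e i) ≠ 0 := by
    rw [← Valuation.ne_zero_iff (p.valuation K), hi]; exact one_ne_zero
  refine isAnisotropicPair_of_forall_not_lt p hi0 (hi.trans hj.symm) fun c hc => ?_
  rw [hi] at hc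
  have hv : ∀ x : K, Valued.v (algebraMap K (p.adicCompletion K) x) = p.valuation K x :=
    fun x => p.valuedAdicCompletion_eq_valuation' x
  -- Were `c` divisible by `p`, the unit `Q (e j)` would dominate the sum.
  have hc1 : p.valuation K (algebraMap A K c) = 1 := by
    refine (p.valuation_le_one c).eq_of_not_lt fun hlt => hc.ne ?_
    rw [Valuation.map_add_eq_of_lt_right, hj]
    rw [map_mul, hi, hj, one_mul, map_pow]
    exact pow_lt_one₀ zero_le hlt two_ne_zero
  obtain ⟨z, hz⟩ := exists_sq_eq_of_valuation_sub_lt (E := p.adicCompletion K)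
    (u := algebraMap K _ (-Q (e j) / Q (e i))) (c := algebraMap K _ (algebraMap A K c))
    (by rw [← map_ofNat (algebraMap K (p.adicCompletion K)) 2, hv, valuation_two p hA2])
    (by rw [hv, hc1]) (by
      rw [← map_pow, ← map_sub, hv]
      rw [show algebraMap A K c ^ 2 - -Q (e j) / Q (e i) =
        (Q (e i) * algebraMap A K c ^ 2 + Q (e j)) / Q (e i) by field_simp; ring, map_div₀, hi,
        div_one]
      exact hc)
  refine not_anisotropicOver_of_sq_mul_eq he hij (z := z) ?_ h
  rw [hz, ← map_mul, ← map_add]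
  rw [show Q (e i) * (-Q (e j) / Q (e i)) + Q (e j) = 0 by field_simp; ring, map_zero]

end Anisotropic
-- Products of two vectors in quaternion coordinates.
section PairQuaternion

open scoped Quaternion

variable {K : Type*} [Field K]

/-- The product of the vectors with coordinates `x` and `y`, in quaternion coordinates, in the
Clifford algebra of the form `a x₀² + b x₁² + c x₂²`. -/
def pairQuaternion (a b c : K) (x y : Fin 3 → K) : ℍ[K, -(a * b), 0, -(a * c)] :=
  ⟨a * (x 0 * y 0) + b * (x 1 * y 1) + c * (x 2 * y 2), x 0 * y 1 - x 1 * y 0,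
    x 0 * y 2 - x 2 * y 0, -(x 1 * y 2 - x 2 * y 1) / a⟩

variable {a b c : K} (x y z : Fin 3 → K)

theorem pairQuaternion_add_left :
    pairQuaternion a b c (x + y) z = pairQuaternion a b c x z + pairQuaternion a b c y z := by
  ext <;> simp [pairQuaternion] <;> ring

theorem pairQuaternion_add_right :
    pairQuaternion a b c x (y + z) = pairQuaternion a b c x y + pairQuaternion a b c x z := by
  ext <;> simp [pairQuaternion] <;> ring

theorem pairQuaternion_smul_left (r : K) :
    pairQuaternion a b c (r • x) y = r • pairQuaternion a b c x y := by
  ext <;> simp [pairQuaternion] <;> ring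

theorem pairQuaternion_smul_right (r : K) :
    pairQuaternion a b c x (r • y) = r • pairQuaternion a b c x y := by
  ext <;> simp [pairQuaternion] <;> ring

theorem pairQuaternion_self {r : K} (hr : a * x 0 ^ 2 + b * x 1 ^ 2 + c * x 2 ^ 2 = r) :
    pairQuaternion a b c x x = algebraMap K _ r := by
  have h1 : x 1 * x 2 - x 2 * x 1 = 0 := by ring
  ext
  · simp [pairQuaternion, ← hr, -QuaternionAlgebra.coe_add]; ring
  · simp [pairQuaternion]; ring
  · simp [pairQuaternion]; ring
  · simp [pairQuaternion, h1]

/-- The relation `(xy)(yz) = Q(y) xz` of the even Clifford algebra. The coordinates come from `i =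
e₀e₁`, `j = e₀e₂`, whence `k = ij = -a e₁e₂`; this explains the division by `a`. -/
theorem pairQuaternion_mul (ha : a ≠ 0) {r : K}
    (hr : a * y 0 ^ 2 + b * y 1 ^ 2 + c * y 2 ^ 2 = r) :
    pairQuaternion a b c x y * pairQuaternion a b c y z = r • pairQuaternion a b c x z := by
  subst hr
  ext <;> simp only [pairQuaternion, QuaternionAlgebra.re_mul, QuaternionAlgebra.imI_mul,
    QuaternionAlgebra.imJ_mul, QuaternionAlgebra.imK_mul, QuaternionAlgebra.re_smul,
    QuaternionAlgebra.imI_smul, QuaternionAlgebra.imJ_smul, QuaternionAlgebra.imK_smul,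
    smul_eq_mul] <;> field_simp <;> ring

end PairQuaternion

/-! ### The even Clifford algebra as a quaternion algebra. -/

section EvenClifford

open CliffordAlgebra
open scoped Quaternion

variable {K V : Type*} [Field K] [AddCommGroup V] [Module K V] {Q : QuadraticForm K V}
  {e : Basis (Fin 3) K V}

theorem evenBilin_swap (x y : V) (h : QuadraticMap.polar Q x y = 0) :
    (even.ι Q).bilin x y = -(even.ι Q).bilin y x := by
  refine Subtype.ext ?_
  have := ι_mul_ι_add_swap (Q := Q) x y
  rw [h, map_zero] at this
  exact eq_neg_of_add_eq_zero_left this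

variable (h2 : (2 : K) ≠ 0) (he : ∀ i j, i ≠ j → bil Q (e i) (e j) = 0) (h0 : Q (e 0) ≠ 0)

/-- The products of pairs of vectors, in quaternion coordinates. -/
noncomputable def pairQuaternionBilin (a b c : K) (e : Basis (Fin 3) K V) :
    V →ₗ[K] V →ₗ[K] ℍ[K, -(a * b), 0, -(a * c)] :=
  LinearMap.mk₂ K (fun x y => pairQuaternion a b c (e.repr x) (e.repr y))
    (fun x y z => by rw [map_add, Finsupp.coe_add, pairQuaternion_add_left])
    (fun c x y => by rw [map_smul, Finsupp.coe_smul, pairQuaternion_smul_left])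
    (fun x y z => by rw [map_add, Finsupp.coe_add, pairQuaternion_add_right])
    (fun c x y => by rw [map_smul, Finsupp.coe_smul, pairQuaternion_smul_right])

theorem pairQuaternionBilin_apply (a b c : K) (x y : V) :
    pairQuaternionBilin a b c e x y = pairQuaternion a b c (e.repr x) (e.repr y) := rfl

include h2 he in
theorem map_eq_sum_three (x : V) : Q (e 0) * e.repr x 0 ^ 2 + Q (e 1) * e.repr x 1 ^ 2 +
    Q (e 2) * e.repr x 2 ^ 2 = Q x := by
  rw [map_eq_sum h2 he x, Fin.sum_univ_three]

/-- The products of pairs of vectors, in quaternion coordinates, as a map out of which the even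
Clifford algebra lifts. -/
noncomputable def evenQuaternionHom :
    EvenHom Q ℍ[K, -(Q (e 0) * Q (e 1)), 0, -(Q (e 0) * Q (e 2))] where
  bilin := pairQuaternionBilin _ _ _ e
  contract x := by
    rw [pairQuaternionBilin_apply, pairQuaternion_self _ (map_eq_sum_three h2 he x)]
  contract_mid x y z := by
    simp only [pairQuaternionBilin_apply]
    exact pairQuaternion_mul _ _ _ h0 (map_eq_sum_three h2 he y)

/-- Quaternion coordinates on the even Clifford algebra of a ternary form. -/
noncomputable def evenToQuaternion :
    even Q →ₐ[K] ℍ[K, -(Q (e 0) * Q (e 1)), 0, -(Q (e 0) * Q (e 2))] :=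
  even.lift Q (evenQuaternionHom h2 he h0)

theorem evenToQuaternion_bilin (x y : V) :
    evenToQuaternion h2 he h0 ((even.ι Q).bilin x y) =
      pairQuaternion _ _ _ (e.repr x) (e.repr y) :=
  even.lift_ι _ _ _ _

include h2 he in
theorem polar_basis_eq_zero {i j : Fin 3} (hij : i ≠ j) : QuadraticMap.polar Q (e i) (e j) = 0 := by
  have := he i j hij
  rw [bil, div_eq_zero_iff] at this
  exact this.resolve_right h2

/-- The quaternion basis `e₀e₁, e₀e₂` of the even Clifford algebra. -/
noncomputable def evenQuaternionBasis (h2 : (2 : K) ≠ 0)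
    (he : ∀ i j, i ≠ j → bil Q (e i) (e j) = 0) :
    QuaternionAlgebra.Basis (even Q) (-(Q (e 0) * Q (e 1))) 0 (-(Q (e 0) * Q (e 2))) where
  i := (even.ι Q).bilin (e 0) (e 1)
  j := (even.ι Q).bilin (e 0) (e 2)
  k := -(Q (e 0) • (even.ι Q).bilin (e 1) (e 2))
  i_mul_i := by
    nth_rw 1 [evenBilin_swap _ _ (polar_basis_eq_zero h2 he (by decide))]
    rw [neg_mul, (even.ι Q).contract_mid, (even.ι Q).contract, Algebra.algebraMap_eq_smul_one]
    module
  j_mul_j := by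
    nth_rw 1 [evenBilin_swap _ _ (polar_basis_eq_zero h2 he (by decide))]
    rw [neg_mul, (even.ι Q).contract_mid, (even.ι Q).contract, Algebra.algebraMap_eq_smul_one]
    module
  i_mul_j := by
    rw [evenBilin_swap (e 0) (e 1) (polar_basis_eq_zero h2 he (by decide)), neg_mul,
      (even.ι Q).contract_mid]
  j_mul_i := by
    rw [evenBilin_swap (e 0) (e 2) (polar_basis_eq_zero h2 he (by decide)), neg_mul,
      (even.ι Q).contract_mid, evenBilin_swap (e 2) (e 1) (polar_basis_eq_zero h2 he (by decide))]
    module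

/-- It suffices to compare on products of two basis vectors. This one-sided inverse gives both the
injectivity of the coordinates and the expansion in `1, e₀e₁, e₀e₂, e₁e₂`. -/
theorem liftHom_evenToQuaternion (x : even Q) :
    (evenQuaternionBasis h2 he).liftHom (evenToQuaternion h2 he h0 x) = x := by
  suffices h : (evenQuaternionBasis h2 he).liftHom.comp (evenToQuaternion h2 he h0) =
      AlgHom.id K (even Q) from DFunLike.congr_fun h x
  apply even.algHom_ext
  refine EvenHom.ext (e.ext fun i => e.ext fun j => ?_)
  simp only [pairQuaternion, EvenHom.compr₂_bilin, LinearMap.compr₂_apply, AlgHom.toLinearMap_apply,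
    AlgHom.comp_apply, evenToQuaternion_bilin, AlgHom.id_apply,
    QuaternionAlgebra.Basis.liftHom_apply, QuaternionAlgebra.Basis.lift, evenQuaternionBasis]
  have hs := fun i j hij => evenBilin_swap (e i) (e j) (polar_basis_eq_zero h2 he (i := i) (j := j) hij)
  fin_cases i <;> fin_cases j <;>
    simp [(even.ι Q).contract, hs 1 0 (by decide), hs 2 0 (by decide), hs 2 1 (by decide),
      smul_smul, h0]

theorem eq_sum_evenToQuaternion (x : even Q) :
    x = algebraMap K (even Q) (evenToQuaternion h2 he h0 x).re +
      (evenToQuaternion h2 he h0 x).imI • (even.ι Q).bilin (e 0) (e 1) +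
      (evenToQuaternion h2 he h0 x).imJ • (even.ι Q).bilin (e 0) (e 2) +
      (-(Q (e 0) * (evenToQuaternion h2 he h0 x).imK)) • (even.ι Q).bilin (e 1) (e 2) := by
  have h := (liftHom_evenToQuaternion h2 he h0 x).symm
  rw [QuaternionAlgebra.Basis.liftHom_apply, QuaternionAlgebra.Basis.lift] at h
  refine h.trans ?_
  simp only [evenQuaternionBasis]
  module

theorem evenToQuaternion_injective : Function.Injective (evenToQuaternion h2 he h0) :=
  Function.LeftInverse.injective (liftHom_evenToQuaternion h2 he h0)

theorem mul_self_eq_trace_norm {c₁ c₃ : K} (y : ℍ[K, c₁, 0, c₃]) {N : K}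
    (hN : y.re ^ 2 - c₁ * y.imI ^ 2 - c₃ * y.imJ ^ 2 + c₁ * c₃ * y.imK ^ 2 = N) :
    y * y - (2 * y.re) • y + algebraMap K ℍ[K, c₁, 0, c₃] N = 0 := by
  ext
  · simp [← hN, -QuaternionAlgebra.coe_add]; ring
  all_goals simp; ring

end EvenClifford

/-! ### Integrality of trace and norm. -/

section Integral

variable {A K : Type*} [CommRing A] [IsIntegrallyClosed A] [Field K] [Algebra A K]
  [IsFractionRing A K]

/-- As `x` is not a scalar, the quadratic is its minimal polynomial. It divides a monic polynomial
over `A`, so its coefficients lie in the integrally closed ring `A`. -/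
theorem mem_range_of_isIntegral_of_quadratic {C : Type*} [Ring C] [Nontrivial C] [Algebra K C]
    [Algebra A C] [IsScalarTower A K C] {x : C} (hx : IsIntegral A x)
    (hxK : x ∉ (algebraMap K C).range) {T N : K}
    (h : x * x - T • x + algebraMap K C N = 0) :
    T ∈ (algebraMap A K).range ∧ N ∈ (algebraMap A K).range := by
  have hxi : IsIntegral K x := hx.tower_top
  have hdeg := (minpoly.two_le_natDegree_iff hxi).2 hxK
  have hquad : (X ^ 2 + (Polynomial.C (-T) * X + Polynomial.C N) : K[X]).Monic :=
    monic_X_pow_add (by compute_degree!)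
  have hquad_deg : (X ^ 2 + (Polynomial.C (-T) * X + Polynomial.C N) : K[X]).natDegree = 2 := by
    compute_degree!
  have hdvd : minpoly K x ∣ X ^ 2 + (Polynomial.C (-T) * X + Polynomial.C N) := by
    refine minpoly.dvd K x ?_
    rw [← h]
    simp only [map_add, map_pow, map_mul, aeval_X, aeval_C, map_neg, neg_mul, Algebra.smul_def]
    rw [sq]; abel
  have heq := eq_of_monic_of_dvd_of_natDegree_le (minpoly.monic hxi) hquad hdvd (by omega)
  obtain ⟨f, hf, hfx⟩ := hx
  have hdf : X ^ 2 + (Polynomial.C (-T) * X + Polynomial.C N) ∣ f.map (algebraMap A K) := by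
    rw [heq]
    refine minpoly.dvd K x ?_
    rw [aeval_map_algebraMap]
    exact hfx
  obtain ⟨g, hg⟩ := IsIntegrallyClosed.eq_map_mul_C_of_dvd K hf hdf
  rw [hquad.leadingCoeff, map_one, mul_one] at hg
  have h0 := congrArg (fun q => Polynomial.coeff q 0) hg
  have h1 := congrArg (fun q => Polynomial.coeff q 1) hg
  simp only [coeff_map, coeff_add, coeff_X_pow, coeff_C_mul, coeff_X, coeff_C] at h0 h1
  norm_num at h0 h1
  exact ⟨⟨-g.coeff 1, by rw [map_neg, h1, neg_neg]⟩, ⟨g.coeff 0, h0⟩⟩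

end Integral
-- The Clifford order of a lattice is finitely generated.
section CliffordOrder

open CliffordAlgebra

variable {A K V : Type*} [CommRing A] [Field K] [Algebra A K]
  [AddCommGroup V] [Module K V] [Module A V] [IsScalarTower A K V]
  {Q : QuadraticForm K V} {L L' : Submodule A V}

theorem adjoin_le_of_mul_mem {C : Type*} [Ring C] [Algebra A C] {G : Set C} {S : Submodule A C}
    (h1 : 1 ∈ S) (hS : ∀ s ∈ S, ∀ g ∈ G, s * g ∈ S) :
    Subalgebra.toSubmodule (Algebra.adjoin A G) ≤ S := by
  intro x hx
  suffices h : ∀ s ∈ S, s * x ∈ S by simpa using h 1 h1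
  rw [Subalgebra.mem_toSubmodule] at hx
  induction hx using Algebra.adjoin_induction with
  | mem x hx => exact fun s hs => hS s hs x hx
  | algebraMap r =>
    intro s hs
    rw [← Algebra.commutes, ← Algebra.smul_def]
    exact S.smul_mem r hs
  | add x y hx hy ihx ihy =>
    intro s hs
    rw [mul_add]
    exact S.add_mem (ihx s hs) (ihy s hs)
  | mul x y hx hy ihx ihy =>
    intro s hs
    rw [← mul_assoc]
    exact ihy _ (ihx s hs)

/-- Ordered monomials span: passing from `S` to `S + S b` handles one more vector `b`, because `b² =
Q(b)` and `bc = 2B(b,c) - cb` push `b` to the right with coefficients in `A`. -/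
theorem exists_fg_mul_ι_mem (h2 : (2 : K) ≠ 0) [DecidableEq V] (s : Finset V)
    (hs : ∀ x ∈ s, ∀ y ∈ s, bil Q x y ∈ (algebraMap A K).range) :
    ∃ S : Submodule A (CliffordAlgebra Q), S.FG ∧ 1 ∈ S ∧ ∀ x ∈ S, ∀ b ∈ s, x * ι Q b ∈ S := by
  induction s using Finset.induction_on with
  | empty =>
    exact ⟨Submodule.span A {1}, Submodule.fg_span_singleton _,
      Submodule.mem_span_singleton_self _, by simp⟩
  | insert b s _ ih =>
    obtain ⟨S, hfg, h1, hS⟩ := ih fun x hx y hy =>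
      hs x (Finset.mem_insert_of_mem hx) y (Finset.mem_insert_of_mem hy)
    refine ⟨S ⊔ S.map (LinearMap.mulRight A (ι Q b)), hfg.sup (hfg.map _),
      Submodule.mem_sup_left h1, ?_⟩
    have hsmul : ∀ x ∈ S, ∀ a : A, x * algebraMap K (CliffordAlgebra Q) (algebraMap A K a) ∈ S := by
      intro x hx a
      rw [← IsScalarTower.algebraMap_apply, ← Algebra.commutes, ← Algebra.smul_def]
      exact S.smul_mem a hx
    intro x hx c hc
    obtain ⟨u, hu, w, hw, rfl⟩ := Submodule.mem_sup.1 hx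
    obtain ⟨w, hwS, rfl⟩ := Submodule.mem_map.1 hw
    rw [add_mul, LinearMap.mulRight_apply, mul_assoc]
    rcases Finset.mem_insert.1 hc with rfl | hc
    · refine add_mem (Submodule.mem_sup_right ⟨u, hu, rfl⟩) (Submodule.mem_sup_left ?_)
      obtain ⟨a, ha⟩ := hs c (Finset.mem_insert_self _ _) c (Finset.mem_insert_self _ _)
      rw [ι_sq_scalar, ← bil_self Q h2, ← ha]
      exact hsmul w hwS a
    · refine add_mem (Submodule.mem_sup_left (hS u hu c hc)) ?_
      obtain ⟨a, ha⟩ := hs b (Finset.mem_insert_self _ _) c (Finset.mem_insert_of_mem hc)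
      have hpol : QuadraticMap.polar Q b c = algebraMap A K (2 * a) := by
        rw [map_mul, map_ofNat, ha, bil, QuadraticMap.polar]
        field_simp
      rw [eq_sub_of_add_eq (ι_mul_ι_add_swap (Q := Q) b c), hpol, mul_sub, ← mul_assoc]
      exact sub_mem (Submodule.mem_sup_left (hsmul w hwS _))
        (Submodule.mem_sup_right ⟨w * ι Q c, hS w hwS c hc, rfl⟩)

theorem cliffordOrder_fg [IsNoetherianRing A] (h2 : (2 : K) ≠ 0) (hL : IsIntegralLattice Q L) :
    (Subalgebra.toSubmodule (cliffordOrder Q L)).FG := by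
  classical
  obtain ⟨s, hs⟩ := hL.isLattice.fg
  have hsL : ∀ x ∈ s, x ∈ L := fun x hx => hs ▸ Submodule.subset_span hx
  obtain ⟨S, hfg, h1, hS⟩ := exists_fg_mul_ι_mem (A := A) (Q := Q) h2 s
    fun x hx y hy => hL.integral x (hsL x hx) y (hsL y hy)
  refine hfg.of_le (adjoin_le_of_mul_mem h1 ?_)
  rintro x hx _ ⟨l, hl, rfl⟩
  have hle : L ≤ S.comap ((LinearMap.mulLeft K x ∘ₗ ι Q).restrictScalars A) := by
    rw [← hs, Submodule.span_le]
    exact fun b hb => hS x hx b hb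
  exact hle hl

theorem evenCliffordOrder_fg [IsNoetherianRing A] (h2 : (2 : K) ≠ 0)
    (hL : IsIntegralLattice Q L) :
    (Subalgebra.toSubmodule (evenCliffordOrder Q L)).FG := by
  refine Submodule.fg_of_fg_map_injective
    (((CliffordAlgebra.even Q).val.restrictScalars A).toLinearMap) Subtype.val_injective ?_
  refine (cliffordOrder_fg h2 hL).of_le ?_
  rintro _ ⟨x, hx, rfl⟩
  exact hx

theorem evenBilin_mem_evenCliffordOrder {x y : V} (hx : x ∈ L) (hy : y ∈ L) :
    (even.ι Q).bilin x y ∈ evenCliffordOrder Q L :=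
  (cliffordOrder Q L).mul_mem (Algebra.subset_adjoin ⟨x, hx, rfl⟩)
    (Algebra.subset_adjoin ⟨y, hy, rfl⟩)

theorem evenCliffordOrder_mono (h : L ≤ L') : evenCliffordOrder Q L ≤ evenCliffordOrder Q L' :=
  fun _ hx => Algebra.adjoin_mono (Set.image_mono h) hx

theorem isOrder_evenCliffordOrder [IsNoetherianRing A] {e : Basis (Fin 3) K V} (h2 : (2 : K) ≠ 0)
    (he : ∀ i j, i ≠ j → bil Q (e i) (e j) = 0) (h0 : Q (e 0) ≠ 0) (heL : ∀ i, e i ∈ L)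
    (hL : IsIntegralLattice Q L) : IsOrder (K := K) (evenCliffordOrder Q L) := by
  refine ⟨evenCliffordOrder_fg h2 hL, eq_top_iff.2 fun x _ => ?_⟩
  have hb : ∀ i j, (even.ι Q).bilin (e i) (e j) ∈
      Submodule.span K (Subalgebra.toSubmodule (evenCliffordOrder Q L) : Set (even Q)) :=
    fun i j => Submodule.subset_span (evenBilin_mem_evenCliffordOrder (heL i) (heL j))
  rw [eq_sum_evenToQuaternion h2 he h0 x, Algebra.algebraMap_eq_smul_one]
  exact add_mem (add_mem (add_mem
    (Submodule.smul_mem _ _ (Submodule.subset_span (one_mem (evenCliffordOrder Q L))))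
    (Submodule.smul_mem _ _ (hb 0 1))) (Submodule.smul_mem _ _ (hb 0 2)))
    (Submodule.smul_mem _ _ (hb 1 2))

/-- If products of pairs of vectors of `L` lie in the subalgebra `S` of the even Clifford algebra,
then so does the even Clifford order of `L`. -/
theorem evenCliffordOrder_le {S : Subalgebra A (even Q)}
    (hS : ∀ x ∈ L, ∀ y ∈ L, (even.ι Q).bilin x y ∈ S) : evenCliffordOrder Q L ≤ S := by
  let T := S.map ((even Q).val.restrictScalars A)
  let P : Submodule A (CliffordAlgebra Q) := L.map ((ι Q).restrictScalars A)
  -- `T + T L` is stable under right multiplication by `L`, so it contains `C(L)`; the summand `T L`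
  -- is odd, so the even elements of the sum lie in `T`.
  let W := Subalgebra.toSubmodule T ⊔ Subalgebra.toSubmodule T * P
  have hodd : ∀ u ∈ Subalgebra.toSubmodule T * P, u ∈ evenOdd Q 1 := by
    intro u hu
    refine Submodule.mul_induction_on hu ?_ fun x y hx hy => add_mem hx hy
    rintro _ ⟨m, -, rfl⟩ _ ⟨l, -, rfl⟩
    have := SetLike.mul_mem_graded (A := evenOdd Q) m.2 (ι_mem_evenOdd_one Q l)
    rwa [zero_add] at this
  have hT : ∀ t ∈ T, ∀ x ∈ L, ∀ y ∈ L, t * (ι Q x * ι Q y) ∈ T := fun t ht x hx y hy =>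
    T.mul_mem ht ⟨_, hS x hx y hy, rfl⟩
  have hW : Subalgebra.toSubmodule (cliffordOrder Q L) ≤ W := by
    refine adjoin_le_of_mul_mem (Submodule.mem_sup_left (one_mem T)) ?_
    rintro w hw _ ⟨l, hl, rfl⟩
    obtain ⟨t, ht, u, hu, rfl⟩ := Submodule.mem_sup.1 hw
    rw [add_mul]
    refine add_mem (Submodule.mem_sup_right (Submodule.mul_mem_mul ht ⟨l, hl, rfl⟩))
      (Submodule.mem_sup_left ?_)
    refine Submodule.mul_induction_on hu ?_ fun x y hx hy => ?_
    · rintro m hm _ ⟨l', hl', rfl⟩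
      rw [mul_assoc]
      exact hT m hm l' hl' l hl
    · rw [add_mul]
      exact add_mem hx hy
  intro x hx
  obtain ⟨t, ht, u, hu, htu⟩ := Submodule.mem_sup.1 (hW (show (x : CliffordAlgebra Q) ∈ _ from hx))
  obtain ⟨t, ht, rfl⟩ := ht
  have hu0 : u = 0 := by
    have hev : u ∈ evenOdd Q 0 := by
      rw [eq_sub_of_add_eq' htu]
      exact sub_mem x.2 t.2
    exact (Submodule.disjoint_def.1 (evenOdd_isCompl Q).disjoint) u hev (hodd u hu)
  rw [hu0, add_zero] at htu
  rwa [← Subtype.ext htu]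

end CliffordOrder
-- Comparing orders with the local order at a prime.
section LocalOrder

open CliffordAlgebra

variable {A K V : Type*} [CommRing A] [IsDomain A] [IsPrincipalIdealRing A] [Field K] [Algebra A K]
  [IsFractionRing A K] [AddCommGroup V] [Module K V] [Module A V] [IsScalarTower A K V]
  {p : HeightOneSpectrum A} {Q : QuadraticForm K V} {L L' : Submodule A V}
  {e : Basis (Fin 3) K V} (h2 : (2 : K) ≠ 0)
  (he : ∀ i j, i ≠ j → bil Q (e i) (e j) = 0) (h0 : Q (e 0) ≠ 0)

variable (p) in
/-- The elements of the even Clifford algebra whose coordinates with respect to the products of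
the orthogonal basis `e` are integral at `p`. -/
noncomputable def localOrder (hQ : ∀ i, p.valuation K (Q (e i)) ≤ 1) : Subalgebra A (even Q) where
  carrier := {x | (evenToQuaternion h2 he h0 x).re ∈ (p.valuation K).integer ∧
    (evenToQuaternion h2 he h0 x).imI ∈ (p.valuation K).integer ∧
    (evenToQuaternion h2 he h0 x).imJ ∈ (p.valuation K).integer ∧
    Q (e 0) * (evenToQuaternion h2 he h0 x).imK ∈ (p.valuation K).integer}
  mul_mem' := by
    rintro x y ⟨x0, x1, x2, x3⟩ ⟨y0, y1, y2, y3⟩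
    have hQ' : ∀ i, Q (e i) ∈ (p.valuation K).integer := hQ
    have q0 := hQ' 0
    have q1 := hQ' 1
    have q2 := hQ' 2
    simp only [Set.mem_ofPred_eq, map_mul, QuaternionAlgebra.re_mul, QuaternionAlgebra.imI_mul,
      QuaternionAlgebra.imJ_mul, QuaternionAlgebra.imK_mul]
    generalize evenToQuaternion h2 he h0 x = x at *
    generalize evenToQuaternion h2 he h0 y = y at *
    generalize (p.valuation K).integer = O at *
    refine ⟨?_, ?_, ?_, ?_⟩
    -- With `Q (e 0) * imK`, up to sign the coefficient of `e₁e₂`, as fourth coordinate, the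
    -- structure constants are polynomial in the `Q (e i)`: no division remains.
    · convert O.sub_mem (O.sub_mem (O.sub_mem (O.mul_mem x0 y0)
        (O.mul_mem (O.mul_mem q0 q1) (O.mul_mem x1 y1)))
        (O.mul_mem (O.mul_mem q0 q2) (O.mul_mem x2 y2)))
        (O.mul_mem (O.mul_mem q1 q2) (O.mul_mem x3 y3)) using 1
      ring
    · convert O.sub_mem (O.add_mem (O.add_mem (O.mul_mem x0 y1) (O.mul_mem x1 y0))
        (O.mul_mem q2 (O.mul_mem x2 y3))) (O.mul_mem q2 (O.mul_mem x3 y2)) using 1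
      ring
    · convert O.sub_mem (O.add_mem (O.add_mem (O.mul_mem x0 y2) (O.mul_mem x2 y0))
        (O.mul_mem q1 (O.mul_mem x3 y1))) (O.mul_mem q1 (O.mul_mem x1 y3)) using 1
      ring
    · convert O.add_mem (O.sub_mem (O.add_mem (O.mul_mem x0 y3)
        (O.mul_mem q0 (O.mul_mem x1 y2))) (O.mul_mem q0 (O.mul_mem x2 y1)))
        (O.mul_mem x3 y0) using 1
      ring
  add_mem' := by
    rintro x y ⟨x0, x1, x2, x3⟩ ⟨y0, y1, y2, y3⟩
    simp only [Set.mem_ofPred_eq, map_add, QuaternionAlgebra.re_add, QuaternionAlgebra.imI_add,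
      QuaternionAlgebra.imJ_add, QuaternionAlgebra.imK_add, mul_add]
    exact ⟨add_mem x0 y0, add_mem x1 y1, add_mem x2 y2, add_mem x3 y3⟩
  algebraMap_mem' r := by
    rw [IsScalarTower.algebraMap_apply A K (even Q), Set.mem_ofPred_eq, AlgHom.commutes]
    simpa [Valuation.mem_integer_iff] using p.valuation_le_one r

theorem mem_localOrder {hQ : ∀ i, p.valuation K (Q (e i)) ≤ 1} {x : even Q} :
    x ∈ localOrder (p := p) h2 he h0 hQ ↔
      p.valuation K (evenToQuaternion h2 he h0 x).re ≤ 1 ∧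
      p.valuation K (evenToQuaternion h2 he h0 x).imI ≤ 1 ∧
      p.valuation K (evenToQuaternion h2 he h0 x).imJ ≤ 1 ∧
      p.valuation K (Q (e 0) * (evenToQuaternion h2 he h0 x).imK) ≤ 1 := Iff.rfl

theorem evenCliffordOrder_le_localOrder (hL : IsAdaptedBasis p Q L e)
    (hQ : ∀ i, p.valuation K (Q (e i)) ≤ 1) :
    evenCliffordOrder Q L ≤ localOrder (p := p) h2 he h0 hQ := by
  refine evenCliffordOrder_le fun x hx y hy => ?_
  rw [mem_localOrder, evenToQuaternion_bilin]
  have hvx := hL.valuation_repr_le x hx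
  have hvy := hL.valuation_repr_le y hy
  simp only [pairQuaternion]
  have hxy : ∀ i j, p.valuation K (e.repr x i * e.repr y j) ≤ 1 := fun i j => by
    rw [map_mul]; exact mul_le_one' (hvx i) (hvy j)
  have hQxy : ∀ i, p.valuation K (Q (e i) * (e.repr x i * e.repr y i)) ≤ 1 := fun i => by
    rw [map_mul]; exact mul_le_one' (hQ i) (hxy i i)
  refine ⟨Valuation.map_add_le _ (Valuation.map_add_le _ (hQxy 0) (hQxy 1)) (hQxy 2),
    Valuation.map_sub_le _ (hxy 0 1) (hxy 1 0), Valuation.map_sub_le _ (hxy 0 2) (hxy 2 0), ?_⟩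
  rw [mul_div_cancel₀ _ h0, Valuation.map_neg]
  exact Valuation.map_sub_le _ (hxy 1 2) (hxy 2 1)

omit [IsDomain A] [IsPrincipalIdealRing A] in
theorem exists_smul_mem_add {M : Type*} [AddCommGroup M] [Module A M] {N : Submodule A M} {x y : M}
    (hx : ∃ s ∉ p.asIdeal, s • x ∈ N) (hy : ∃ s ∉ p.asIdeal, s • y ∈ N) :
    ∃ s ∉ p.asIdeal, s • (x + y) ∈ N := by
  obtain ⟨s, hs, hsx⟩ := hx
  obtain ⟨t, ht, hty⟩ := hy
  refine ⟨s * t, fun h => (p.isPrime.mem_or_mem h).elim hs ht, ?_⟩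
  rw [smul_add, mul_smul, mul_smul, smul_comm s t x]
  exact N.add_mem (N.smul_mem t hsx) (N.smul_mem s hty)

theorem exists_smul_mem_of_valuation_le {M : Type*} [AddCommGroup M] [Module A M] [Module K M]
    [IsScalarTower A K M] {N : Submodule A M} {c : K} {x : M} (hc : p.valuation K c ≤ 1)
    (hx : x ∈ N) : ∃ s ∉ p.asIdeal, s • (c • x) ∈ N := by
  obtain ⟨a, s, hs, h⟩ := exists_mul_eq_of_valuation_le_one p hc
  refine ⟨s, hs, ?_⟩
  rw [← algebraMap_smul K s, smul_smul, h, algebraMap_smul]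
  exact N.smul_mem a hx

/-- Together with `evenCliffordOrder_le_localOrder`, this identifies the localization of `C₀(L)` at
`p` with the local order. -/
theorem exists_smul_mem_evenCliffordOrder (heL : ∀ i, e i ∈ L)
    {hQ : ∀ i, p.valuation K (Q (e i)) ≤ 1} {x : even Q}
    (hx : x ∈ localOrder (p := p) h2 he h0 hQ) :
    ∃ s ∉ p.asIdeal, s • x ∈ evenCliffordOrder Q L := by
  obtain ⟨x0, x1, x2, x3⟩ := (mem_localOrder h2 he h0).1 hx
  have hb : ∀ i j, (even.ι Q).bilin (e i) (e j) ∈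
      Subalgebra.toSubmodule (evenCliffordOrder Q L) := fun i j =>
    evenBilin_mem_evenCliffordOrder (heL i) (heL j)
  have key : ∃ s ∉ p.asIdeal, s • x ∈ Subalgebra.toSubmodule (evenCliffordOrder Q L) := by
    rw [eq_sum_evenToQuaternion h2 he h0 x, Algebra.algebraMap_eq_smul_one]
    exact exists_smul_mem_add (exists_smul_mem_add (exists_smul_mem_add
      (exists_smul_mem_of_valuation_le x0 (one_mem (evenCliffordOrder Q L)))
      (exists_smul_mem_of_valuation_le x1 (hb 0 1)))
      (exists_smul_mem_of_valuation_le x2 (hb 0 2)))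
      (exists_smul_mem_of_valuation_le (by rwa [Valuation.map_neg]) (hb 1 2))
  exact key

theorem exists_smul_mem_lattice (heL : ∀ i, e i ∈ L) {x : V}
    (hx : ∀ i, p.valuation K (e.repr x i) ≤ 1) : ∃ s ∉ p.asIdeal, s • x ∈ L := by
  rw [← e.sum_repr x, Fin.sum_univ_three]
  exact exists_smul_mem_add (exists_smul_mem_add (exists_smul_mem_of_valuation_le (hx 0) (heL 0))
    (exists_smul_mem_of_valuation_le (hx 1) (heL 1)))
    (exists_smul_mem_of_valuation_le (hx 2) (heL 2))

/-- Elements of an order are integral, hence so are the reduced trace `2 re` and the reduced norm.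
The norm is grouped into the two binary forms that the parity argument separates. -/
theorem valuation_trace_norm_le_one (hA2 : IsUnit (2 : A)) {Λ : Subalgebra A (even Q)}
    (hΛ : IsOrder (K := K) Λ) {x : even Q} (hx : x ∈ Λ) :
    p.valuation K (evenToQuaternion h2 he h0 x).re ≤ 1 ∧
    p.valuation K ((evenToQuaternion h2 he h0 x).re ^ 2 +
      Q (e 0) * Q (e 1) * (evenToQuaternion h2 he h0 x).imI ^ 2 +
      Q (e 2) * (Q (e 0) * (evenToQuaternion h2 he h0 x).imJ ^ 2 +
        Q (e 1) * (Q (e 0) * (evenToQuaternion h2 he h0 x).imK) ^ 2)) ≤ 1 := by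
  have : Nontrivial (even Q) := (evenToQuaternion h2 he h0).toRingHom.domain_nontrivial
  have hint : IsIntegral A x := IsIntegral.of_mem_of_fg Λ hΛ.fg x hx
  have hvr : ∀ r ∈ (algebraMap A K).range, p.valuation K r ≤ 1 := by
    rintro _ ⟨a, rfl⟩
    exact p.valuation_le_one a
  -- For a scalar, the characteristic quadratic is not the minimal polynomial.
  by_cases hxK : x ∈ (algebraMap K (even Q)).range
  · obtain ⟨r, rfl⟩ := hxK
    have hr := (isIntegral_algebraMap_iff (algebraMap K (even Q)).injective).1 hint
    obtain ⟨a, ha⟩ := IsIntegrallyClosed.isIntegral_iff.1 hr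
    have hvr := hvr r ⟨a, ha⟩
    rw [AlgHom.commutes]
    simpa [pow_le_one_iff] using hvr
  · have hquad := mul_self_eq_trace_norm (evenToQuaternion h2 he h0 x) rfl
    rw [← map_mul (evenToQuaternion h2 he h0), ← map_smul (evenToQuaternion h2 he h0),
      ← map_sub (evenToQuaternion h2 he h0), ← AlgHom.commutes (evenToQuaternion h2 he h0),
      ← map_add (evenToQuaternion h2 he h0), map_eq_zero_iff _ (evenToQuaternion_injective h2 he h0)] at hquad
    obtain ⟨hT, hN⟩ := mem_range_of_isIntegral_of_quadratic hint hxK hquad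
    refine ⟨by simpa [valuation_two p hA2] using hvr _ hT, ?_⟩
    convert hvr _ hN using 2
    ring

/-- The product `e₀x` has `x₁, x₂` among its coordinates and `e₁x` has `-x₀`, so `C₀(L)` determines
`L` locally. -/
theorem isMaximalLattice_of_isMaximalOrder (hA2 : IsUnit (2 : A)) (hA : ¬ IsField A)
    (hdim : finrank K V = 3) (hQ : ∀ x, (∀ y, bil Q x y = 0) → x = 0)
    (hQ0 : ∀ (p : HeightOneSpectrum A) (e : Basis (Fin 3) K V), IsAdaptedBasis p Q L e →
      ∀ i, Q (e i) ≠ 0)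
    (hL : IsIntegralLattice Q L) (hmax : IsMaximalOrder (K := K) (evenCliffordOrder Q L)) :
    IsMaximalLattice Q L := by
  have h2 : (2 : K) ≠ 0 := two_ne_zero_of_isUnit hA2
  refine ⟨hL, fun L' hL' hle x hx => mem_of_forall_exists_smul_mem hA fun p => ?_⟩
  obtain ⟨e, he⟩ := exists_isAdaptedBasis p Q hdim hA2 hQ hL
  have hQe := hQ0 p e he
  have hord : IsOrder (K := K) (evenCliffordOrder Q L') :=
    isOrder_evenCliffordOrder h2 he.ortho (hQe 0) (fun i => hle (he.mem i)) hL'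
  have hle' := hmax.le_of_ge hord (evenCliffordOrder_mono hle)
  have hQ1 : ∀ i, p.valuation K (Q (e i)) ≤ 1 := fun i => by
    rw [← bil_self Q h2]
    exact valuation_bil_le_one p hL (he.mem i) (he.mem i)
  have hmem : ∀ i, (even.ι Q).bilin (e i) x ∈ localOrder (p := p) h2 he.ortho (hQe 0) hQ1 :=
    fun i => evenCliffordOrder_le_localOrder h2 he.ortho (hQe 0) he hQ1
      (hle' (evenBilin_mem_evenCliffordOrder (hle (he.mem i)) hx))
  have m0 := (mem_localOrder h2 he.ortho (hQe 0)).1 (hmem 0)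
  have m1 := (mem_localOrder h2 he.ortho (hQe 0)).1 (hmem 1)
  rw [evenToQuaternion_bilin] at m0 m1
  simp only [pairQuaternion, Basis.repr_self] at m0 m1
  refine exists_smul_mem_lattice he.mem fun i => ?_
  fin_cases i
  · simpa using m1.2.1
  · simpa using m0.2.1
  · simpa using m0.2.2.1

/-- Trace duality: the products of `x` with the `eᵢeⱼ` stay in `Λ`, and their traces are the
coordinates of `x` up to units at `p`. -/
theorem mem_localOrder_of_unimodular (hA2 : IsUnit (2 : A)) (heL : ∀ i, e i ∈ L)
    (hQ1 : ∀ i, p.valuation K (Q (e i)) = 1) {Λ : Subalgebra A (even Q)}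
    (hΛ : IsOrder (K := K) Λ) (hle : evenCliffordOrder Q L ≤ Λ) {x : even Q} (hx : x ∈ Λ) :
    x ∈ localOrder (p := p) h2 he h0 (fun i => (hQ1 i).le) := by
  have htr : ∀ i j, p.valuation K
      (evenToQuaternion h2 he h0 x * evenToQuaternion h2 he h0 ((even.ι Q).bilin (e i) (e j))).re
        ≤ 1 := by
    intro i j
    rw [← map_mul (evenToQuaternion h2 he h0)]
    exact (valuation_trace_norm_le_one h2 he h0 hA2 hΛ
      (Λ.mul_mem hx (hle (evenBilin_mem_evenCliffordOrder (heL i) (heL j))))).1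
  have t1 := htr 0 1
  have t2 := htr 0 2
  have t3 := htr 1 2
  rw [evenToQuaternion_bilin, QuaternionAlgebra.re_mul] at t1 t2 t3
  simp only [pairQuaternion, Basis.repr_self] at t1 t2 t3
  rw [mem_localOrder]
  refine ⟨(valuation_trace_norm_le_one h2 he h0 hA2 hΛ hx).1, ?_, ?_, ?_⟩
  · simpa [hQ1] using t1
  · simpa [hQ1] using t2
  · simpa [hQ1, h0] using t3

theorem le_one_of_sq_le_one {a : ℤᵐ⁰} (h : exp (-1) * a ^ 2 ≤ 1) : a ≤ 1 := by
  rcases eq_or_ne a 0 with rfl | ha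
  · exact zero_le
  rw [← exp_log ha, ← exp_nsmul, ← exp_add, ← exp_zero, exp_le_exp] at h
  rw [← exp_log ha, ← exp_zero, exp_le_exp]
  simp only [nsmul_eq_mul, Nat.cast_ofNat] at h
  omega

/-- Summands whose valuations have different parities cannot cancel. -/
theorem le_one_of_valuation_add_le_one (v : Valuation K ℤᵐ⁰) {x y : K} {a b : ℤᵐ⁰}
    (hx : v x = a ^ 2) (hy : v y = exp (-1) * b ^ 2) (h : v (x + y) ≤ 1) : a ≤ 1 ∧ b ≤ 1 := by
  suffices hmax : v x ≤ 1 ∧ v y ≤ 1 by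
    rw [hx, hy] at hmax
    exact ⟨(pow_le_one_iff two_ne_zero).1 hmax.1, le_one_of_sq_le_one hmax.2⟩
  by_cases hxy : v x = v y
  · have hab := hx.symm.trans (hxy.trans hy)
    have ha : a = 0 := by
      by_contra ha
      have hb : b ≠ 0 := by
        rintro rfl
        exact ha (by simpa using hab)
      rw [← exp_log ha, ← exp_log hb, ← exp_nsmul, ← exp_nsmul, ← exp_add, exp_inj] at hab
      simp only [nsmul_eq_mul, Nat.cast_ofNat] at hab
      omega
    rw [← hxy, hx, ha]
    simp
  · rw [v.map_add_of_distinct_val hxy] at h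
    exact max_le_iff.1 h

/-- The norm is a sum of an even and an odd part, each measuring the larger of two coordinates.
Hence `Λ` need not contain `C₀(L)`: integral norm alone suffices. -/
theorem mem_localOrder_of_isAnisotropicPair (hA2 : IsUnit (2 : A))
    (hQ : ∀ i, p.valuation K (Q (e i)) ≤ 1)
    (hv0 : p.valuation K (Q (e 0)) = 1) (hv1 : p.valuation K (Q (e 1)) = 1)
    (hv2 : p.valuation K (Q (e 2)) = exp (-1)) (hpair : IsAnisotropicPair p (Q (e 0)) (Q (e 1)))
    {Λ : Subalgebra A (even Q)} (hΛ : IsOrder (K := K) Λ) {x : even Q} (hx : x ∈ Λ) :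
    x ∈ localOrder (p := p) h2 he h0 hQ := by
  have hN := (valuation_trace_norm_le_one (p := p) h2 he h0 hA2 hΛ hx).2
  rw [mem_localOrder]
  generalize evenToQuaternion h2 he h0 x = y at *
  have hmax : ∀ a b : ℤᵐ⁰, max (a ^ 2) (b ^ 2) = max a b ^ 2 := fun a b =>
    ((pow_left_mono (M := ℤᵐ⁰) 2).map_max).symm
  have hfst : p.valuation K (y.re ^ 2 + Q (e 0) * Q (e 1) * y.imI ^ 2) =
      max (p.valuation K y.re) (p.valuation K y.imI) ^ 2 := by
    -- Multiplying by the unit `a` turns `re² + ab imI²` into `a re² + b (a imI)²`.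
    have h := hpair y.re (Q (e 0) * y.imI)
    rw [map_mul, hv0, hv1, one_mul, one_mul, one_mul, hmax] at h
    rw [← h, ← one_mul (p.valuation K (_ + _)), ← hv0, ← map_mul]
    congr 1
    ring
  have hsnd : p.valuation K (Q (e 2) * (Q (e 0) * y.imJ ^ 2 + Q (e 1) * (Q (e 0) * y.imK) ^ 2)) =
      exp (-1) * max (p.valuation K y.imJ) (p.valuation K (Q (e 0) * y.imK)) ^ 2 := by
    rw [map_mul, hpair, hv0, hv1, hv2, one_mul, one_mul, hmax]
  obtain ⟨ha, hb⟩ := le_one_of_valuation_add_le_one _ hfst hsnd hN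
  exact ⟨(max_le_iff.1 ha).1, (max_le_iff.1 ha).2, (max_le_iff.1 hb).1, (max_le_iff.1 hb).2⟩

end LocalOrder
-- Gluing the local statements.
section Main

variable {A K V : Type*} [CommRing A] [IsDomain A] [IsPrincipalIdealRing A] [Field K] [Algebra A K]
  [IsFractionRing A K] [AddCommGroup V] [Module K V] [Module A V] [IsScalarTower A K V]
  {Q : QuadraticForm K V} {L M : Submodule A V}

theorem valuation_eq_exp_neg_one_of_squarefree (p : HeightOneSpectrum A) {d : A}
    (hd : Squarefree d) (hp : d ∈ p.asIdeal) :
    p.valuation K (algebraMap A K d) = exp (-1) := by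
  obtain ⟨t, ht, ht0, hvt⟩ := exists_generator (K := K) p
  refine (le_exp_sub_one_of_lt_exp (n := 0)
    ((p.valuation_lt_one_iff_mem d).2 hp)).eq_or_lt.resolve_right fun h => ?_
  have hdvd := pow_dvd_of_valuation_le p ht (n := 2) (le_exp_sub_one_of_lt_exp h)
  rw [sq] at hdvd
  exact p.isPrime.ne_top (by rw [ht]; exact Ideal.span_singleton_eq_top.2 (hd t hdvd))

theorem isMaximalOrder_of_isMaximalLattice [Invertible (2 : K)]
    (hfin : ∀ p : HeightOneSpectrum A, Finite (A ⧸ p.asIdeal)) (hA2 : IsUnit (2 : A))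
    (hA : ¬ IsField A) (hdim : finrank K V = 3) (hQ : ∀ x, (∀ y, bil Q x y = 0) → x = 0)
    (hQ0 : ∀ (p : HeightOneSpectrum A) (e : Basis (Fin 3) K V) (L : Submodule A V),
      IsAdaptedBasis p Q L e → ∀ i, Q (e i) ≠ 0)
    {m : Fin 3 → V} (hM : IsIntegralLattice Q M) (hmM : ∀ i, m i ∈ M) {d : A} (hd : Squarefree d)
    (hmd : (Matrix.of fun i j => bil Q (m i) (m j)).det = algebraMap A K d)
    (hani : ∀ p : HeightOneSpectrum A, d ∈ p.asIdeal → AnisotropicOver Q (p.adicCompletion K))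
    (hL : IsMaximalLattice Q L) : IsMaximalOrder (K := K) (evenCliffordOrder Q L) := by
  have h2 : (2 : K) ≠ 0 := two_ne_zero_of_isUnit hA2
  -- Any prime will do: it only supplies an orthogonal basis of `V` inside `L`.
  obtain ⟨p₀⟩ : Nonempty (HeightOneSpectrum A) := by
    obtain ⟨I, hI⟩ := Ideal.exists_maximal A
    exact ⟨I, hI.isPrime, Ring.ne_bot_of_isMaximal_of_not_isField hI hA⟩
  obtain ⟨e₀, he₀⟩ := exists_isAdaptedBasis p₀ Q hdim hA2 hQ hL.prop
  refine ⟨isOrder_evenCliffordOrder h2 he₀.ortho (hQ0 p₀ e₀ L he₀ 0) he₀.mem hL.prop,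
    fun Λ hΛ hle x hx => ?_⟩
  suffices h : x ∈ Subalgebra.toSubmodule (evenCliffordOrder Q L) from h
  refine mem_of_forall_exists_smul_mem hA fun p => ?_
  obtain ⟨e, he⟩ := exists_isAdaptedBasis p Q hdim hA2 hQ hL.prop
  by_cases hp : d ∈ p.asIdeal
  · have := hfin p
    obtain ⟨e', he', hv0, hv1, hv2⟩ := exists_isAdaptedBasis_of_odd hA2 hL he (m := m)
      (by rw [hmd, valuation_eq_exp_neg_one_of_squarefree p hd hp])
    have hpair := isAnisotropicPair_of_anisotropicOver hA2 he'.ortho (by decide) hv0 hv1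
      (hani p hp)
    have hQ1 : ∀ i, p.valuation K (Q (e' i)) ≤ 1 := fun i => by
      rw [← bil_self Q h2]
      exact valuation_bil_le_one p hL.prop (he'.mem i) (he'.mem i)
    exact exists_smul_mem_evenCliffordOrder h2 he'.ortho (hQ0 p e' L he' 0) he'.mem
      (mem_localOrder_of_isAnisotropicPair h2 he'.ortho (hQ0 p e' L he' 0) hA2 hQ1 hv0 hv1 hv2
        hpair hΛ hx)
  · obtain ⟨f, hf⟩ := exists_isAdaptedBasis p Q hdim hA2 hQ hM
    have hv := valuation_map_basis_eq_one_of_isMaximalLattice hA2 hL he hM hf hmM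
      (by rw [hmd, valuation_algebraMap_eq_one p hp])
    exact exists_smul_mem_evenCliffordOrder h2 he.ortho (hQ0 p e L he 0) he.mem
      (mem_localOrder_of_unimodular h2 he.ortho (hQ0 p e L he 0) hA2 he.mem hv hΛ hle hx)

/-- Over a principal ideal domain with finite residue fields of odd order: in a ternary space that
contains an integral lattice of square-free determinant `d` and is anisotropic at all primes
dividing `d`, an integral lattice is maximal if and only if its even Clifford order is. -/
theorem isMaximalLattice_iff_isMaximalOrder [Invertible (2 : K)]
    (hfin : ∀ p : HeightOneSpectrum A, Finite (A ⧸ p.asIdeal)) (hA2 : IsUnit (2 : A))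
    (hA : ¬ IsField A) (hdim : finrank K V = 3)
    (m : Basis (Fin 3) K V) (hM : IsIntegralLattice Q M) (hmM : ∀ i, m i ∈ M) {d : A}
    (hd : Squarefree d)
    (hmd : (Matrix.of fun i j => bil Q (m i) (m j)).det = algebraMap A K d)
    (hani : ∀ p : HeightOneSpectrum A, d ∈ p.asIdeal → AnisotropicOver Q (p.adicCompletion K))
    (hL : IsIntegralLattice Q L) :
    IsMaximalLattice Q L ↔ IsMaximalOrder (K := K) (evenCliffordOrder Q L) := by
  have h2 : (2 : K) ≠ 0 := two_ne_zero_of_isUnit hA2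
  have hdet : (Matrix.of fun i j => bil Q (m i) (m j)).det ≠ 0 := by
    rw [hmd]
    simpa using hd.ne_zero
  have hQ : ∀ x, (∀ y, bil Q x y = 0) → x = 0 := fun x => eq_zero_of_forall_bil_eq_zero m hdet
  have hQ0 : ∀ (p : HeightOneSpectrum A) (e : Basis (Fin 3) K V) (L : Submodule A V),
      IsAdaptedBasis p Q L e → ∀ i, Q (e i) ≠ 0 := by
    intro p e L he i hi
    apply hdet
    rw [det_bil_eq h2 he.ortho, Finset.prod_eq_zero (Finset.mem_univ i) hi, mul_zero]
  exact ⟨isMaximalOrder_of_isMaximalLattice hfin hA2 hA hdim hQ hQ0 hM hmM hd hmd hani,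
    isMaximalLattice_of_isMaximalOrder hA2 hA hdim hQ (fun p e he => hQ0 p e L he) hL⟩

end Main

theorem finite_polynomial_quotient {F : Type*} [Field F] [Finite F] {I : Ideal F[X]} (hI : I ≠ ⊥) :
    Finite (F[X] ⧸ I) := by
  obtain ⟨f, rfl⟩ := (IsPrincipalIdealRing.principal I).principal
  have hf : f ≠ 0 := by
    rintro rfl
    exact hI (by simp)
  have : Module.Finite F (AdjoinRoot f) := (AdjoinRoot.powerBasis hf).finite
  exact Module.finite_of_finite F (M := AdjoinRoot f)

end TernaryLattice

theorem mainTheorem8 {F : Type*} [Field F] [Finite F] [NeZero (2 : F)]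
    [DecidableEq (RatFunc F)]
    {V : Type*} [AddCommGroup V] [Module (RatFunc F) V] [Module F[X] V]
    [IsScalarTower F[X] (RatFunc F) V]
    (hdim : Module.finrank (RatFunc F) V = 3)
    (Q : QuadraticForm (RatFunc F) V)
    (hdef : TernaryLattice.AnisotropicOver Q (RatFunc.CompletionAtInfty F))
    (D : F[X]) (hD : Squarefree D)
    (hadm : ∃ M : Submodule F[X] V,
      TernaryLattice.IsIntegralLattice Q M ∧ TernaryLattice.HasDeterminant Q M D)
    (hani : ∀ p : IsDedekindDomain.HeightOneSpectrum F[X], D ∈ p.asIdeal →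
      TernaryLattice.AnisotropicOver Q (p.adicCompletion (RatFunc F)))
    (L : Submodule F[X] V) (hL : TernaryLattice.IsIntegralLattice Q L) :
    TernaryLattice.IsMaximalLattice Q L ↔
      TernaryLattice.IsMaximalOrder (K := RatFunc F) (TernaryLattice.evenCliffordOrder Q L) := by
  obtain ⟨M, hM, b, u, hbu⟩ := hadm
  have hu : IsUnit (C (u : F) ^ 2) := (isUnit_C.2 u.isUnit).pow 2
  have hspan : ⊤ ≤ Submodule.span (RatFunc F) (Set.range fun i => (b i : V)) := by
    rw [← hM.isLattice.span_eq_top, Submodule.span_le]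
    intro x hx
    have hsum := congrArg Subtype.val (b.sum_repr ⟨x, hx⟩)
    rw [SetLike.mem_coe, ← show _ = x from hsum]
    rw [Submodule.coe_sum]
    refine Submodule.sum_mem _ fun i _ => ?_
    rw [Submodule.coe_smul, ← algebraMap_smul (RatFunc F)]
    exact Submodule.smul_mem _ _ (Submodule.subset_span ⟨i, rfl⟩)
  let m := basisOfTopLeSpanOfCardEqFinrank (fun i => (b i : V)) hspan (by simp [hdim])
  have hm : ∀ i, m i = b i := fun i => by simp [m]
  -- The exact determinant, with its square unit factor, serves as `d`: it is square-free and has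
  -- the same prime divisors as `D`.
  refine TernaryLattice.isMaximalLattice_iff_isMaximalOrder
    (fun p => TernaryLattice.finite_polynomial_quotient p.ne_bot) ?_ (Polynomial.not_isField F) hdim
    m hM (fun i => by rw [hm]; exact (b i).2) (d := C (u : F) ^ 2 * D) ?_ ?_ (fun p hp => ?_) hL
  · rw [← map_ofNat C 2]
    exact isUnit_C.2 (NeZero.ne (2 : F)).isUnit
  · exact ((associated_isUnit_mul_left_iff hu).2 (Associated.refl D)).squarefree_iff.2 hD
  · simpa only [hm] using hbu
  · exact hani p ((Ideal.unit_mul_mem_iff_mem _ hu).1 hp)
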